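/- **Conventions.** For a set $I$ let $\binom{I}{d}$ be the set of its $d$-element subsets, and let $[n]=\{1,\dots,n\}$. An $\mathcal X$-valued $d$-dimensional random array on $[n]$ is a family $\boldsymbol X=\langle X_s : s\in\binom{[n]}{d}\rangle$ of $\mathcal X$-valued random variables on a common probability space; for $J\subseteq[n]$ with $|J|\ge d$ put $\boldsymbol X_J=\langle X_s:s\in\binom Jd\rangle$. For $\eta\ge 0$, $\boldsymbol X$ is $\eta$-spreadable if for all $J,K\subseteq [n]$ with $|J|=|K|\ge d$ the laws of $\boldsymbol X_J$ and $\boldsymbol X_K$ (with $\binom Jd$ and $\binom Kd$ identified via the increasing bijection $J\to K$) are at total variation distance $\sup_A|P_J(A)-P_K(A)|\le\eta$. **Constants.** For positive integers $d,m,k$ with $k\ge d$ and $\varepsilon>0$ put $$\theta(d,k,\varepsilon)=\frac{\varepsilon^2}{2^7k^{2d}},\qquad \ell_0(d,m,k,\varepsilon)=k^{m\lfloor 1/\theta(d,k,\varepsilon)\rfloor},\qquad \overline m(d,m,k,\varepsilon)=m^{(\ell_0(d,m,k,\varepsilon)\,d)^d},\qquad \overline\varepsilon(d,m,k,\varepsilon)=\frac{\varepsilon}{8}\,\overline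 m(d,m,k,\varepsilon)^{-k^{d-1}}.$$ Define $\eta,n_0,v$ by recursion on $d$. For $d=1$, with $\ell_0=\ell_0(1,m,k,\varepsilon)$, $$\eta(1,m,k,\varepsilon)=\frac{\varepsilon^3}{2^{12}k^3}m^{-3\ell_0},\qquad n_0(1,m,k,\varepsilon)=(k+1)k\,\ell_0,\qquad v(1,m,k,\varepsilon)=2^{22}m^{\ell_0+1}k^8\varepsilon^{-8}.$$ For $d\ge2$, with $\ell_0,\overline m,\overline\varepsilon$ evaluated at $(d,m,k,\varepsilon)$, $$\eta(d,m,k,\varepsilon)=\min\Big\{\frac{\varepsilon^3}{2^{12}k^{3d}}\,m^{-(k(d+1)\ell_0)^d},\ \eta(d-1,\overline m,k,\overline\varepsilon)\Big\},$$ $$n_0(d,m,k,\varepsilon)=k\,\ell_0\,\big(n_0(d-1,\overline m,k,\overline\varepsilon)+1\big),\qquad v(d,m,k,\varepsilon)=4^{24}\,m\,k^{d2^{d+2}}\varepsilon^{-2^{d+2}}\,v(d-1,\overline m,k,\overline\varepsilon).$$ **Theorem.** Let $d,m,k$ be positive integers with $m\ge2$ and $k\ge d$, and let $0<\varepsilon\le1$.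 Let $n\ge n_0(d,m,k,\varepsilon)$ be an integer, let $\mathcal X$ be a set with $|\mathcal X|=m$, and let $\boldsymbol X=\langle X_s:s\in\binom{[n]}d\rangle$ be an $\mathcal X$-valued, $\eta(d,m,k,\varepsilon)$-spreadable, $d$-dimensional random array on $[n]$. Then there exist a finite probability space $(\Omega,\mu)$ with $|\Omega|\le v(d,m,k,\varepsilon)$ and a partition $\langle E^a:a\in\mathcal X\rangle$ of $\Omega^{\{0\}\cup[d]}$ into nonempty sets such that for every $M\in\binom{[n]}k$, every nonempty $\mathcal F\subseteq\binom Md$ and every collection $(a_s)_{s\in\mathcal F}$ of elements of $\mathcal X$, $$\Big|\,\mathbb P\Big(\bigcap_{s\in\mathcal F}[X_s=a_s]\Big)-\int\prod_{s\in\mathcal F}\mathbf 1_{E^{a_s}}(\boldsymbol\omega_{\{0\}\cup s})\,d\boldsymbol\mu(\boldsymbol\omega)\Big|\le\varepsilon.$$ Here $\boldsymbol\mu$ is the product measure on $\Omega^{\{0\}\cup\mathbb N}$, $\mathbb N=\{1,2,\dots\}$, with every factor equipped with $\mu$, and $\boldsymbol\omega_{\{0\}\cup s}=(\omega_0,\omega_{j_1},\dots,\omega_{j_d})$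 for $s=\{j_1<\dots<j_d\}$. -/

import Mathlib

open MeasureTheory

noncomputable section

namespace SpreadableArray

/-! ### Random arrays and approximate spreadability

For a linearly ordered set `I`, `Set.powersetCard I d` is the set of all `d`-element subsets of `I`
(as finsets). A `d`-dimensional `𝒳`-valued random array on `I` is a family
`X : Set.powersetCard I d → S → 𝒳` of random variables on a probability space `(S, P)`. -/

/-- Total variation distance: the supremum of `|μ A - ν A|` over all measurable sets `A`. -/
def tvDist {α : Type*} [MeasurableSpace α] (μ ν : Measure α) : ℝ :=
  ⨆ A : {A : Set α // MeasurableSet A}, |μ.real A - ν.real A|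

/-- The law of the subarray of `X` determined by a finite set `J` with `p` elements. The `d`-subsets
of `J` are named by the `d`-subsets of `{0, ..., p - 1}` through the increasing bijection
`{0, ..., p - 1} → J`, so that the laws of the subarrays determined by two sets of the same
cardinality are measures on one and the same space. -/
def subarrayLaw {I S 𝒳 : Type*} [LinearOrder I] [MeasurableSpace S] [MeasurableSpace 𝒳] {d : ℕ}
    (P : Measure S) (X : Set.powersetCard I d → S → 𝒳) {p : ℕ} (J : Finset I) (hJ : J.card = p) :
    Measure (Set.powersetCard (Fin p) d → 𝒳) :=
  P.map fun ω t => X (Set.powersetCard.map d (J.orderEmbOfFin hJ).toEmbedding t) ω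

/-- The random array `X` is `η`-spreadable: the laws of the subarrays determined by any two finite
sets of the same cardinality, which is at least `d`, are at total variation distance at most `η`. -/
def IsSpreadable {I S 𝒳 : Type*} [LinearOrder I] [MeasurableSpace S] [MeasurableSpace 𝒳] {d : ℕ}
    (P : Measure S) (X : Set.powersetCard I d → S → 𝒳) (η : ℝ) : Prop :=
  ∀ (p : ℕ), d ≤ p → ∀ (J K : Finset I) (hJ : J.card = p) (hK : K.card = p),
    tvDist (subarrayLaw P X J hJ) (subarrayLaw P X K hK) ≤ η

/-! ### The numerical invariants -/

/-- `θ(d,k,ε) = ε² / (2⁷ k^{2d})`. -/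
def theta (d k : ℕ) (ε : ℝ) : ℝ := ε ^ 2 / (2 ^ 7 * (k : ℝ) ^ (2 * d))

/-- `ℓ₀(d,m,k,ε) = k^{m ⌊1/θ(d,k,ε)⌋}`. -/
def ell0 (d m k : ℕ) (ε : ℝ) : ℕ := k ^ (m * ⌊1 / theta d k ε⌋₊)

/-- `m̄(d,m,k,ε) = m^{(ℓ₀(d,m,k,ε) d)^d}`. -/
def mbar (d m k : ℕ) (ε : ℝ) : ℕ := m ^ ((ell0 d m k ε * d) ^ d)

/-- `ε̄(d,m,k,ε) = (ε / 8) m̄(d,m,k,ε)^{-k^{d-1}}`. -/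
def epsbar (d m k : ℕ) (ε : ℝ) : ℝ := ε / 8 * ((mbar d m k ε : ℝ) ^ (k ^ (d - 1)))⁻¹

/-- `η(d,m,k,ε)`, by recursion on `d ≥ 1` (the value at `d = 0` is a placeholder). -/
def eta : ℕ → ℕ → ℕ → ℝ → ℝ
  | 0, _, _, _ => 1
  | 1, m, k, ε => ε ^ 3 / (2 ^ 12 * (k : ℝ) ^ 3) * ((m : ℝ) ^ (3 * ell0 1 m k ε))⁻¹
  | d + 2, m, k, ε =>
      min (ε ^ 3 / (2 ^ 12 * (k : ℝ) ^ (3 * (d + 2))) *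
            ((m : ℝ) ^ ((k * (d + 3) * ell0 (d + 2) m k ε) ^ (d + 2)))⁻¹)
          (eta (d + 1) (mbar (d + 2) m k ε) k (epsbar (d + 2) m k ε))

/-- `n₀(d,m,k,ε)`, by recursion on `d ≥ 1` (the value at `d = 0` is a placeholder). -/
def n0 : ℕ → ℕ → ℕ → ℝ → ℕ
  | 0, _, _, _ => 1
  | 1, m, k, ε => (k + 1) * k * ell0 1 m k ε
  | d + 2, m, k, ε =>
      k * ell0 (d + 2) m k ε * (n0 (d + 1) (mbar (d + 2) m k ε) k (epsbar (d + 2) m k ε) + 1)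

/-- `v(d,m,k,ε)`, by recursion on `d ≥ 1` (the value at `d = 0` is a placeholder). -/
def v : ℕ → ℕ → ℕ → ℝ → ℝ
  | 0, _, _, _ => 1
  | 1, m, k, ε => 2 ^ 22 * (m : ℝ) ^ (ell0 1 m k ε + 1) * (k : ℝ) ^ 8 * (ε ^ 8)⁻¹
  | d + 2, m, k, ε =>
      4 ^ 24 * (m : ℝ) * (k : ℝ) ^ ((d + 2) * 2 ^ (d + 4)) * (ε ^ (2 ^ (d + 4)))⁻¹ *
        v (d + 1) (mbar (d + 2) m k ε) k (epsbar (d + 2) m k ε)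

/-! ### Partitions and restriction of coordinates -/

/-- The sets `E a` form a partition: they are nonempty, pairwise disjoint, and cover everything. -/
def IsPartition {ι α : Type*} (E : ι → Set α) : Prop :=
  (∀ a, (E a).Nonempty) ∧ Pairwise (fun a b => Disjoint (E a) (E b)) ∧ ⋃ a, E a = Set.univ

/-- For `ω = (ω₀, ω₁, ω₂, ...)` and a `d`-subset `s = {j₁ < ... < j_d}` of `[n] = {1, ..., n}`, the
restriction `(ω₀, ω_{j₁}, ..., ω_{j_d})` of `ω` to `{0} ∪ s`. Here `[n]` is represented by `Fin n`,
with `i : Fin n` standing for the integer `i + 1`, and `{0} ∪ [d]` is `Fin (d + 1)`. -/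
def restrict {Ω : Type*} {n d : ℕ} (ω : ℕ → Ω) (s : Set.powersetCard (Fin n) d) :
    Fin (d + 1) → Ω :=
  Fin.cons (ω 0) fun i : Fin d =>
    ω (((s : Finset (Fin n)).orderEmbOfFin (Set.powersetCard.card_eq s) i : ℕ) + 1)

end SpreadableArray

end

/-! The proof is by induction on the dimension, with an energy increment argument in each step. All
random variables take finitely many values, so laws are weights and expectations are finite sums.

Let the array have dimension `d + 1`. Blow every point up to a block of `l` points and adjoin an
initial block. The subarrays spanned by `d` blocks and the initial one form a `d`-dimensional array
(`lower`), again spreadable. Condition an entry on the data of the `d + 1` faces of its chain. The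
energy of this conditional law is at most 1, so along the scales `1, k, k², ...` some passage from
`l` to `k * l` gains little energy (`exists_scale`).

At such a scale the entries over `k` points are nearly conditionally independent given the block
array. For a chain `s`, `squeeze` pushes everything between consecutive points of `s` into enlarged
blocks of `s`, and whatever precedes `s` into the initial block; spreadability makes this nearly
invisible. Afterwards every entry whose chain is not transversal to `s` is a function of the face
data at scale `k * l`, and by Pythagoras this finer data predicts the entry at `s` hardly better
than the data at scale `l` (`abs_ex_ind_sub_mul_le`). Indicators can therefore be replaced by
conditional probabilities one at a time (`abs_ex_prod_sub_prod_le`).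

The induction hypothesis models the block array by independent vertex variables. The conditional
probabilities then define a random colouring of `(d + 1)`-tuples of vertices. Multiplying the vertex
space by a large uniform factor makes coincidences rare, and a second moment bound yields one
deterministic colouring with nearly the expected pattern densities (`exists_coloring`). The
recursion ends at dimension 0, where the array is a single random variable: this is the coordinate
`ω₀`. -/

noncomputable section

namespace SpreadableArray

/-! ### Finite probability spaces given by weights -/

/-- Nonnegative weights of total mass one. -/
structure IsWeight {Θ : Type*} [Fintype Θ] (w : Θ → ℝ) : Prop where
  nonneg : ∀ x, 0 ≤ w x
  sum_eq_one : ∑ x, w x = 1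

/-- Expectation with respect to weights on a finite set. -/
def ex {Θ : Type*} [Fintype Θ] (w f : Θ → ℝ) : ℝ := ∑ x, w x * f x

section ex

variable {Θ β γ : Type*} [Fintype Θ] {w : Θ → ℝ}

lemma ex_add (f g : Θ → ℝ) : ex w (fun x => f x + g x) = ex w f + ex w g := by
  simp [ex, mul_add, Finset.sum_add_distrib]

lemma ex_sub (f g : Θ → ℝ) : ex w (fun x => f x - g x) = ex w f - ex w g := by
  simp [ex, mul_sub, Finset.sum_sub_distrib]

lemma ex_const_mul (c : ℝ) (f : Θ → ℝ) : ex w (fun x => c * f x) = c * ex w f := by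
  simp only [ex, Finset.mul_sum]
  exact Finset.sum_congr rfl fun _ _ => by ring

lemma ex_sum {ι : Type*} (s : Finset ι) (f : ι → Θ → ℝ) :
    ex w (fun x => ∑ i ∈ s, f i x) = ∑ i ∈ s, ex w (f i) := by
  simp only [ex, Finset.mul_sum]
  exact Finset.sum_comm

lemma IsWeight.ex_const (hw : IsWeight w) (c : ℝ) : ex w (fun _ => c) = c := by
  simp [ex, ← Finset.sum_mul, hw.sum_eq_one]

lemma IsWeight.ex_mono (hw : IsWeight w) {f g : Θ → ℝ} (h : ∀ x, f x ≤ g x) :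
    ex w f ≤ ex w g :=
  Finset.sum_le_sum fun x _ => mul_le_mul_of_nonneg_left (h x) (hw.nonneg x)

lemma IsWeight.ex_nonneg (hw : IsWeight w) {f : Θ → ℝ} (h : ∀ x, 0 ≤ f x) : 0 ≤ ex w f :=
  Finset.sum_nonneg fun x _ => mul_nonneg (hw.nonneg x) (h x)

lemma IsWeight.abs_ex_le (hw : IsWeight w) {f : Θ → ℝ} {c : ℝ} (h : ∀ x, |f x| ≤ c) :
    |ex w f| ≤ c := by
  rw [abs_le]
  constructor
  · rw [← hw.ex_const (-c)]
    exact hw.ex_mono fun x => (abs_le.1 (h x)).1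
  · rw [← hw.ex_const c]
    exact hw.ex_mono fun x => (abs_le.1 (h x)).2

lemma IsWeight.nonempty (hw : IsWeight w) : Nonempty Θ := by
  by_contra h
  rw [not_nonempty_iff] at h
  simpa using hw.sum_eq_one

/-- The Cauchy-Schwarz inequality against a function bounded by one. -/
lemma IsWeight.abs_ex_mul_le (hw : IsWeight w) {f h : Θ → ℝ} (hh : ∀ x, |h x| ≤ 1) :
    |ex w (fun x => f x * h x)| ≤ √(ex w fun x => f x ^ 2) := by
  apply Real.abs_le_sqrt
  have key : (∑ x, w x * (f x * h x)) ^ 2 ≤ (∑ x, w x * f x ^ 2) * ∑ x, w x * h x ^ 2 := by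
    apply Finset.sum_sq_le_sum_mul_sum_of_sq_le_mul
    · exact fun x _ => mul_nonneg (hw.nonneg x) (sq_nonneg _)
    · exact fun x _ => mul_nonneg (hw.nonneg x) (sq_nonneg _)
    · intro x _; exact le_of_eq (by ring)
  have h1 : ∑ x, w x * h x ^ 2 ≤ 1 := by
    rw [← hw.sum_eq_one]
    refine Finset.sum_le_sum fun x _ => ?_
    have : h x ^ 2 ≤ 1 := by
      rw [← sq_abs]; exact pow_le_one₀ (abs_nonneg _) (hh x)
    nlinarith [hw.nonneg x]
  have h0 : 0 ≤ ∑ x, w x * f x ^ 2 :=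
    Finset.sum_nonneg fun x _ => mul_nonneg (hw.nonneg x) (sq_nonneg _)
  calc _ ≤ _ := key
    _ ≤ _ := by unfold ex; nlinarith

/-- The indicator of the event `a = b`. -/
def ind {α : Type*} (a b : α) : ℝ := open Classical in if a = b then 1 else 0

lemma ind_nonneg {α : Type*} (a b : α) : 0 ≤ ind a b := by unfold ind; split_ifs <;> norm_num

lemma ind_le_one {α : Type*} (a b : α) : ind a b ≤ 1 := by unfold ind; split_ifs <;> norm_num

lemma sum_ind {α : Type*} [Fintype α] (a : α) : ∑ b, ind a b = 1 := by
  classical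
  simp [ind]

lemma ind_mul_ind_self {α : Type*} (a b : α) : ind a b * ind a b = ind a b := by
  unfold ind; split_ifs <;> norm_num

/-- Disintegration of a finite expectation along the values of a map. -/
lemma ex_eq_sum_ind [Fintype β] (B : Θ → β) (f : Θ → ℝ) :
    ex w f = ∑ y, ex w fun x => ind (B x) y * f x := by
  rw [← ex_sum]
  congr 1
  funext x
  rw [← Finset.sum_mul, sum_ind, one_mul]

/-! ### Conditional distributions and their energy. -/

/-- `g` is a version of the conditional distribution of `Z` given `B`. -/
structure IsCondDist {𝒳 : Type*} [Fintype 𝒳] (w : Θ → ℝ) (Z : Θ → 𝒳) (B : Θ → β)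
    (g : β → 𝒳 → ℝ) : Prop where
  nonneg : ∀ y a, 0 ≤ g y a
  sum_eq_one : ∀ y, ∑ a, g y a = 1
  ex_eq : ∀ a (h : β → ℝ),
    ex w (fun x => ind (Z x) a * h (B x)) = ex w fun x => g (B x) a * h (B x)

lemma IsCondDist.le_one {𝒳 : Type*} [Fintype 𝒳] {Z : Θ → 𝒳} {B : Θ → β} {g : β → 𝒳 → ℝ}
    (hg : IsCondDist w Z B g) (y : β) (a : 𝒳) : g y a ≤ 1 := by
  rw [← hg.sum_eq_one y]
  exact Finset.single_le_sum (fun b _ => hg.nonneg y b) (Finset.mem_univ a)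

/-- The usual quotient of joint by marginal mass, extended over null values so as to be a
probability vector everywhere. Models evaluate `g` at face data that may be null for the original
array. -/
lemma IsWeight.exists_isCondDist {𝒳 : Type*} [Fintype 𝒳] (hw : IsWeight w) (Z : Θ → 𝒳)
    (B : Θ → β) : ∃ g, IsCondDist w Z B g := by
  classical
  obtain ⟨x₀⟩ := hw.nonempty
  let p : β → ℝ := fun y => ex w fun x => ind (B x) y
  let q : β → 𝒳 → ℝ := fun y a => ex w fun x => ind (Z x) a * ind (B x) y
  have hqsum : ∀ y, ∑ a, q y a = p y := by
    intro y
    simp only [q, p]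
    rw [← ex_sum]
    congr 1
    funext x
    rw [← Finset.sum_mul, sum_ind, one_mul]
  have hq0 : ∀ y a, 0 ≤ q y a := fun y a =>
    hw.ex_nonneg fun x => mul_nonneg (ind_nonneg _ _) (ind_nonneg _ _)
  -- On null values any probability vector serves; a point mass at `Z x₀` is at hand.
  refine ⟨fun y a => if p y = 0 then ind (Z x₀) a else q y a / p y, ?_, ?_, ?_⟩
  · intro y a
    split_ifs
    · exact ind_nonneg _ _
    · exact div_nonneg (hq0 y a) (hw.ex_nonneg fun x => ind_nonneg _ _)
  · intro y
    split_ifs with h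
    · exact sum_ind _
    · rw [← Finset.sum_div, hqsum, div_self h]
  · intro a h
    -- `β` need not be finite, so the disintegration runs over the image of `B`.
    have hfin : ∀ f : Θ → ℝ,
        ex w f = ∑ y ∈ Finset.univ.image B, ex w fun x => ind (B x) y * f x := by
      intro f
      rw [← ex_sum]
      congr 1
      funext x
      rw [← Finset.sum_mul]
      have : ∑ y ∈ Finset.univ.image B, ind (B x) y = 1 := by
        simp [ind]
      rw [this, one_mul]
    rw [hfin, hfin (fun x => _ * h (B x))]
    refine Finset.sum_congr rfl fun y _ => ?_
    have e1 : (ex w fun x => ind (B x) y * (ind (Z x) a * h (B x))) = h y * q y a := by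
      simp only [q]
      rw [← ex_const_mul]
      congr 1
      funext x
      by_cases hx : B x = y
      · simp [ind, hx, mul_comm]
      · simp [ind, hx]
    have e2 : ∀ g : β → ℝ, (ex w fun x => ind (B x) y * (g (B x) * h (B x))) =
        h y * (g y * p y) := by
      intro g
      simp only [p]
      rw [← ex_const_mul, ← ex_const_mul]
      congr 1
      funext x
      by_cases hx : B x = y
      · simp [ind, hx, mul_comm]
      · simp [ind, hx]
    rw [e1, e2 (fun y => if p y = 0 then ind (Z x₀) a else q y a / p y)]
    congr 1
    split_ifs with h0
    · rw [h0, mul_zero]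
      refine le_antisymm ?_ (hq0 y a)
      rw [← h0, ← hqsum y]
      exact Finset.single_le_sum (fun b _ => hq0 y b) (Finset.mem_univ a)
    · field_simp

/-- The energy of a family of functions. -/
def energy {𝒳 : Type*} [Fintype 𝒳] (w : Θ → ℝ) (B : Θ → β) (g : β → 𝒳 → ℝ) : ℝ :=
  ∑ a, ex w fun x => g (B x) a ^ 2

lemma energy_nonneg {𝒳 : Type*} [Fintype 𝒳] (hw : IsWeight w) (B : Θ → β) (g : β → 𝒳 → ℝ) :
    0 ≤ energy w B g :=
  Finset.sum_nonneg fun _ _ => hw.ex_nonneg fun _ => sq_nonneg _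

lemma IsCondDist.energy_le_one {𝒳 : Type*} [Fintype 𝒳] (hw : IsWeight w) {Z : Θ → 𝒳} {B : Θ → β}
    {g : β → 𝒳 → ℝ} (hg : IsCondDist w Z B g) : energy w B g ≤ 1 := by
  unfold energy
  rw [← ex_sum, ← hw.ex_const 1]
  refine hw.ex_mono fun x => ?_
  rw [← hg.sum_eq_one (B x)]
  refine Finset.sum_le_sum fun a _ => ?_
  nlinarith [hg.nonneg (B x) a, hg.le_one (B x) a]

/-- Pythagoras for two nested conditional distributions. -/
lemma IsCondDist.ex_sub_sq {𝒳 : Type*} [Fintype 𝒳] {Z : Θ → 𝒳} {A : Θ → γ} {B : Θ → β}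
    {f : γ → 𝒳 → ℝ} {g : β → 𝒳 → ℝ} (hf : IsCondDist w Z A f) (hg : IsCondDist w Z B g)
    (r : β → γ) (hr : ∀ x, A x = r (B x)) (a : 𝒳) :
    (ex w fun x => (g (B x) a - f (A x) a) ^ 2) =
      (ex w fun x => g (B x) a ^ 2) - ex w fun x => f (A x) a ^ 2 := by
  have h1 := hf.ex_eq a (fun y => f y a)
  have h2 := hg.ex_eq a (fun y => f (r y) a)
  simp only [← hr] at h2
  have h3 : (ex w fun x => (g (B x) a - f (A x) a) ^ 2) =
      (ex w fun x => g (B x) a ^ 2) + (ex w fun x => f (A x) a * f (A x) a)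
        - 2 * ex w fun x => g (B x) a * f (A x) a := by
    rw [← ex_const_mul, ← ex_add, ← ex_sub]
    congr 1; funext x; ring
  rw [h3, ← h2, h1]
  simp only [sq]
  ring

lemma IsCondDist.ex_sub_sq_le {𝒳 : Type*} [Fintype 𝒳] (hw : IsWeight w) {Z : Θ → 𝒳} {A : Θ → γ}
    {B : Θ → β} {f : γ → 𝒳 → ℝ} {g : β → 𝒳 → ℝ} (hf : IsCondDist w Z A f)
    (hg : IsCondDist w Z B g) (r : β → γ) (hr : ∀ x, A x = r (B x)) (a : 𝒳) :
    (ex w fun x => (g (B x) a - f (A x) a) ^ 2) ≤ energy w B g - energy w A f := by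
  unfold energy
  rw [← Finset.sum_sub_distrib]
  simp only [← hf.ex_sub_sq hg r hr]
  exact Finset.single_le_sum (f := fun a => ex w fun x => (g (B x) a - f (A x) a) ^ 2)
    (fun b _ => hw.ex_nonneg fun x => sq_nonneg _) (Finset.mem_univ a)

/-- If the energy gained by passing from `A` to the finer `B` is small, then the conditional
distribution given `A` is nearly indistinguishable from the indicator by functions of `B`. -/
lemma IsCondDist.abs_ex_sub_mul_le {𝒳 : Type*} [Fintype 𝒳] (hw : IsWeight w) {Z : Θ → 𝒳}
    {A : Θ → γ} {B : Θ → β} {f : γ → 𝒳 → ℝ} {g : β → 𝒳 → ℝ} (hf : IsCondDist w Z A f)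
    (hg : IsCondDist w Z B g) (r : β → γ) (hr : ∀ x, A x = r (B x)) (a : 𝒳)
    (h : Θ → ℝ) (hh : ∀ x, |h x| ≤ 1) (hB : ∀ x x', B x = B x' → h x = h x') :
    |ex w fun x => (ind (Z x) a - f (A x) a) * h x| ≤ √(energy w B g - energy w A f) := by
  obtain ⟨h', rfl⟩ : ∃ h' : β → ℝ, h = h' ∘ B :=
    (Function.factorsThrough_iff h).1 fun x x' e => hB x x' e
  have h1 := hg.ex_eq a h'
  have h2 : (ex w fun x => (ind (Z x) a - f (A x) a) * (h' ∘ B) x) =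
      ex w fun x => (g (B x) a - f (A x) a) * (h' ∘ B) x := by
    simp only [sub_mul, ex_sub, Function.comp]
    rw [h1]
  rw [h2]
  exact (hw.abs_ex_mul_le hh).trans (Real.sqrt_le_sqrt (hf.ex_sub_sq_le hw hg r hr a))

end ex

/-! ### Arrays indexed by chains -/

instance {d : ℕ} {A : Type*} [LinearOrder A] [Finite A] : Finite (Fin d ↪o A) :=
  Finite.of_injective (fun f => (f : Fin d → A)) DFunLike.coe_injective

instance {d : ℕ} {A : Type*} [LinearOrder A] [Finite A] : Fintype (Fin d ↪o A) :=
  Fintype.ofFinite _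

instance {d : ℕ} {A : Type*} [LinearOrder A] : DecidableEq (Fin d ↪o A) := Classical.decEq _

lemma card_chain_le {d : ℕ} {A : Type*} [LinearOrder A] [Fintype A] :
    Fintype.card (Fin d ↪o A) ≤ Fintype.card A ^ d := by
  refine (Fintype.card_le_of_injective (fun f : Fin d ↪o A => (f : Fin d → A))
    DFunLike.coe_injective).trans ?_
  simp

/-- An array indexed by the chains of length `d` in `A`. -/
abbrev Arr (d : ℕ) (A 𝒳 : Type*) [LinearOrder A] := (Fin d ↪o A) → 𝒳

/-- The subarray along an order embedding. -/
def Arr.pull {d : ℕ} {A B 𝒳 : Type*} [LinearOrder A] [LinearOrder B] (f : A ↪o B)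
    (x : Arr d B 𝒳) : Arr d A 𝒳 := fun t => x (t.trans f)

/-- Approximate spreadability, tested against bounded functions of subarrays. -/
def Spreads {Θ I 𝒳 : Type*} [Fintype Θ] [LinearOrder I] {d : ℕ} (w : Θ → ℝ) (X : Θ → Arr d I 𝒳)
    (η : ℝ) : Prop :=
  ∀ (A : Type) [LinearOrder A] [Finite A] (φ ψ : A ↪o I) (G : Arr d A 𝒳 → ℝ), (∀ x, |G x| ≤ 1) →
    |(ex w fun θ => G ((X θ).pull φ)) - ex w fun θ => G ((X θ).pull ψ)| ≤ 2 * η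

lemma Spreads.pull {Θ I J 𝒳 : Type*} [Fintype Θ] [LinearOrder I] [LinearOrder J] {d : ℕ}
    {w : Θ → ℝ} {X : Θ → Arr d I 𝒳} {η : ℝ} (hX : Spreads w X η) (f : J ↪o I) :
    Spreads w (fun θ => (X θ).pull f) η :=
  fun A _ _ φ ψ G hG => hX A (φ.trans f) (ψ.trans f) G hG

/-! ### Templates: a linear order with a block after each of its points, and an initial block -/

/-- The linear order `A` with a least element adjoined and each point blown up to `l` points. -/
abbrev Tm (A : Type*) (l : ℕ) := Lex (WithBot A × Fin l)

section Tm

variable {A B C : Type*} [LinearOrder A] [LinearOrder B] [LinearOrder C] {l l' : ℕ}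

lemma Tm.lt_iff {x y : Tm A l} :
    x < y ↔ (ofLex x).1 < (ofLex y).1 ∨ (ofLex x).1 = (ofLex y).1 ∧ (ofLex x).2 < (ofLex y).2 :=
  Prod.Lex.lt_iff

/-- Templates are functorial. -/
def Tm.map (f : A ↪o B) (h : l ≤ l') : Tm A l ↪o Tm B l' :=
  OrderEmbedding.ofStrictMono
    (fun x => toLex (f.withBotMap (ofLex x).1, Fin.castLE h (ofLex x).2)) (by
      intro x y hxy
      rw [Tm.lt_iff] at hxy ⊢
      rcases hxy with h1 | ⟨h1, h2⟩
      · exact Or.inl (f.withBotMap.strictMono h1)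
      · exact Or.inr ⟨congrArg f.withBotMap h1, h2⟩)

lemma Tm.map_apply (f : A ↪o B) (h : l ≤ l') (x : Tm A l) :
    Tm.map f h x = toLex (WithBot.map f (ofLex x).1, Fin.castLE h (ofLex x).2) := rfl

lemma Tm.map_trans (f : A ↪o B) (g : B ↪o C) {l'' : ℕ} (h : l ≤ l') (h' : l' ≤ l'') :
    (Tm.map f h).trans (Tm.map g h') = Tm.map (f.trans g) (h.trans h') := by
  refine DFunLike.ext _ _ fun x => ofLex.injective (Prod.ext ?_ rfl)
  exact WithBot.map_map _ _ _

/-- The copy of `A` inside the template over `A`. -/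
def Tm.top (hl : 0 < l) : A ↪o Tm A l :=
  OrderEmbedding.ofStrictMono (fun a => toLex ((a : WithBot A), ⟨0, hl⟩)) (by
    intro a b hab
    rw [Tm.lt_iff]
    exact Or.inl (WithBot.coe_lt_coe.2 hab))

instance [Finite A] : Finite (Tm A l) :=
  Finite.of_equiv (Option A × Fin l) toLex

lemma coe_le_imp_le {x y : WithBot A} (h : ∀ a : A, (a : WithBot A) ≤ x → (a : WithBot A) ≤ y) :
    x ≤ y := by
  induction x with
  | bot => exact bot_le
  | coe a => exact h a le_rfl

end Tm

lemma card_tm {A : Type*} {l : ℕ} [Fintype A] :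
    Fintype.card (Tm A l) = (Fintype.card A + 1) * l := by
  rw [Fintype.card_lex, Fintype.card_prod, Fintype.card_fin]
  congr 1
  exact Fintype.card_option

/-! ### The lower-dimensional array of blocks -/

/-- The `d`-dimensional array of blocks of a `(d + 1)`-dimensional array on a template. -/
def lower {d : ℕ} {A 𝒳 : Type*} [LinearOrder A] {l l' : ℕ} (h : l ≤ l')
    (x : Arr (d + 1) (Tm A l') 𝒳) : Arr d A (Arr (d + 1) (Tm (Fin d) l) 𝒳) :=
  fun u => x.pull (Tm.map u h)

lemma lower_pull {d : ℕ} {A B 𝒳 : Type*} [LinearOrder A] [LinearOrder B] {l l' l'' : ℕ}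
    (h : l ≤ l') (h' : l' ≤ l'') (f : A ↪o B) (x : Arr (d + 1) (Tm B l'') 𝒳) :
    lower h (x.pull (Tm.map f h')) = (lower (h.trans h') x).pull f := by
  funext u t
  simp only [lower, Arr.pull, ← Tm.map_trans u f h h']
  rfl

/-- A subarray of the block array over `A` is a function of the subarray over the template `Tm A l`,
so every test of the block array is already a test of `X`. -/
lemma Spreads.lower {Θ 𝒳 : Type*} {I : Type} [Fintype Θ] [LinearOrder I] {d l l' : ℕ}
    {w : Θ → ℝ} {X : Θ → Arr (d + 1) (Tm I l') 𝒳} {η : ℝ} (hX : Spreads w X η) (h : l ≤ l') :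
    Spreads w (fun θ => lower h (X θ)) η := by
  intro A _ _ φ ψ G hG
  have := hX (Tm A l) (Tm.map φ h) (Tm.map ψ h) (fun x => G (SpreadableArray.lower le_rfl x))
    (fun x => hG _)
  simpa only [lower_pull] using this

/-- The faces of a chain. -/
def face {d : ℕ} {A : Type*} [LinearOrder A] (s : Fin (d + 1) ↪o A) (i : Fin (d + 1)) :
    Fin d ↪o A := (Fin.succAboveOrderEmb i).trans s

/-- The data carried by the faces of a chain. -/
def bdry {d : ℕ} {A 𝒳 : Type*} [LinearOrder A] (s : Fin (d + 1) ↪o A) (y : Arr d A 𝒳) :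
    Fin (d + 1) → 𝒳 := fun i => y (face s i)

/-! ### Squeezing the points of a template into the blocks of a chain -/

section Squeeze

variable {d k : ℕ} (s : Fin d ↪o Fin k)

/-- The index of the last point of the chain `s` which is not beyond a given point. -/
def cls (j : WithBot (Fin k)) : WithBot (Fin d) :=
  (Finset.univ.filter fun i : Fin d => (s i : WithBot (Fin k)) ≤ j).sup fun i =>
    (i : WithBot (Fin d))

/-- This adjunction between `cls s` and the embedding `s` determines `cls` and gives its further
properties. -/
lemma coe_le_cls {i : Fin d} {j : WithBot (Fin k)} :
    (i : WithBot (Fin d)) ≤ cls s j ↔ (s i : WithBot (Fin k)) ≤ j := by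
  unfold cls
  rw [Finset.le_sup_iff (WithBot.bot_lt_coe i)]
  simp only [Finset.mem_filter, Finset.mem_univ, true_and, WithBot.coe_le_coe]
  constructor
  · rintro ⟨i', h1, h2⟩
    exact (WithBot.coe_le_coe.2 (s.monotone h2)).trans h1
  · exact fun h => ⟨i, h, le_rfl⟩

lemma cls_mono : Monotone (cls s) := by
  intro j j' h
  refine coe_le_imp_le fun i hi => ?_
  rw [coe_le_cls] at hi ⊢
  exact hi.trans h

lemma cls_bot : cls s ⊥ = ⊥ := by
  refine le_bot_iff.1 (coe_le_imp_le fun i hi => ?_)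
  rw [coe_le_cls] at hi
  simp at hi

lemma cls_coe (i : Fin d) : cls s (s i) = i := by
  refine le_antisymm (coe_le_imp_le fun i' hi => ?_) ?_
  · rw [coe_le_cls] at hi
    simpa using hi
  · rw [coe_le_cls]

lemma cls_map (i : WithBot (Fin d)) : cls s (WithBot.map s i) = i := by
  induction i with
  | bot => exact cls_bot s
  | coe i => exact cls_coe s i

lemma map_cls_le (j : WithBot (Fin k)) : WithBot.map s (cls s j) ≤ j := by
  rcases h : cls s j with _ | i
  · exact bot_le
  · exact (coe_le_cls s).1 h.ge

/-- The position of a point. -/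
def code (j : WithBot (Fin k)) : ℕ := WithBot.recBotCoe 0 (fun i => (i : ℕ) + 1) j

lemma code_coe (j : Fin k) : code (j : WithBot (Fin k)) = j + 1 := rfl
lemma code_bot : code (⊥ : WithBot (Fin k)) = 0 := rfl

lemma code_strictMono : StrictMono (code (k := k)) := by
  intro a b h
  induction b with
  | bot => simp at h
  | coe b =>
    induction a with
    | bot => simp [code_coe, code_bot]
    | coe a => simpa [code_coe] using h

lemma code_le (j : WithBot (Fin k)) : code j ≤ k := by
  induction j with
  | bot => simp [code_bot]
  | coe j => rw [code_coe]; exact j.2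

/-- The distance of a point to the last point of the chain before it. -/
def off (j : WithBot (Fin k)) : ℕ := code j - code (WithBot.map s (cls s j))

lemma off_map (i : WithBot (Fin d)) : off s (WithBot.map s i) = 0 := by
  unfold off; rw [cls_map, Nat.sub_self]

lemma off_lt (hd : 0 < d) (j : WithBot (Fin k)) : off s j < k := by
  have h1 := code_le j
  unfold off
  rcases h : cls s j with _ | i
  · change code j - 0 < k
    -- In the initial class the offset is the full position, at most `k`; it is strictly smaller
    -- because the point lies before the first point of `s`, which exists as `0 < d`.
    have : ¬ ((⟨0, hd⟩ : Fin d) : WithBot (Fin d)) ≤ cls s j := by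
      rw [h]; exact WithBot.not_coe_le_bot _
    rw [coe_le_cls, not_le] at this
    have := code_strictMono this
    rw [code_coe] at this
    omega
  · change code j - code ((s i : Fin k) : WithBot (Fin k)) < k
    rw [code_coe]
    have := i.pos
    have := (s i).pos
    omega

lemma off_lt_off {j j' : WithBot (Fin k)} (h : j < j') (hc : cls s j = cls s j') :
    off s j < off s j' := by
  unfold off
  rw [← hc]
  have h1 := code_strictMono h
  have h2 := code_strictMono.monotone (map_cls_le s j)
  omega

/-- The squeezing map: the points between consecutive points of the chain, and their blocks, are
moved into the (`k` times larger) block of the former. -/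
def squeeze (hd : 0 < d) (l : ℕ) : Tm (Fin k) l ↪o Tm (Fin d) (k * l) :=
  OrderEmbedding.ofStrictMono
    (fun x => toLex (cls s (ofLex x).1, ⟨off s (ofLex x).1 * l + (ofLex x).2, by
      have h1 := off_lt s hd (ofLex x).1
      have h2 := (ofLex x).2.2
      nlinarith⟩)) (by
      intro x y hxy
      rw [Tm.lt_iff] at hxy ⊢
      simp only [ofLex_toLex, Fin.mk_lt_mk]
      rcases hxy with h | ⟨h1, h2⟩
      · rcases (cls_mono s h.le).lt_or_eq with h' | h'
        · exact Or.inl h'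
        · refine Or.inr ⟨h', ?_⟩
          have h3 := off_lt_off s h h'
          have h4 := (ofLex x).2.2
          nlinarith
      · refine Or.inr ⟨congrArg _ h1, ?_⟩
        rw [h1]
        simpa using h2)

/-- A point of `s` is its own class, with offset zero. Squeezing thus leaves the entry at `s` and
its face data at scale `l` in place. -/
lemma map_trans_squeeze (hd : 0 < d) (l : ℕ) (hl : l ≤ k * l) :
    (Tm.map s le_rfl).trans (squeeze s hd l) = Tm.map (RelEmbedding.refl _) hl := by
  refine DFunLike.ext _ _ fun x => ?_
  apply ofLex.injective
  refine Prod.ext ?_ (Fin.ext ?_)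
  · change cls s (WithBot.map s (ofLex x).1) = WithBot.map id (ofLex x).1
    rw [cls_map, WithBot.map_id]; rfl
  · change off s (WithBot.map s (ofLex x).1) * l + ((ofLex x).2 : ℕ) = ((ofLex x).2 : ℕ)
    rw [off_map]; simp

end Squeeze

/-! ### Approximate conditional independence -/

lemma exists_trans_eq {A B C : Type*} [LinearOrder A] [LinearOrder B] [LinearOrder C] (f : A ↪o C)
    (c : B ↪o C) (h : ∀ b, c b ∈ Set.range f) : ∃ t : B ↪o A, t.trans f = c := by
  choose t ht using h
  refine ⟨OrderEmbedding.ofStrictMono t fun b b' hb => ?_, DFunLike.ext _ _ ht⟩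
  rw [← f.lt_iff_lt, ht, ht]
  exact c.lt_iff_lt.2 hb

section Transversal

variable {d k l : ℕ} (s : Fin (d + 1) ↪o Fin k)

/-- A chain is transversal to `s` if it has exactly one point in each of the intervals between
consecutive points of `s`. -/
def Transversal (c : Fin (d + 1) ↪o Tm (Fin k) l) : Prop :=
  ∀ i, cls s (ofLex (c i)).1 = (i : WithBot (Fin (d + 1)))

/-- Pigeonhole: a transversal chain needs `d + 1` distinct non-initial blocks, and a template over
`d` points has only `d`. Hence functions of the block array are admissible test functions for every
`s`. -/
lemma not_transversal_trans_map (u : Fin d ↪o Fin k) (t : Fin (d + 1) ↪o Tm (Fin d) l) :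
    ¬ Transversal s (t.trans (Tm.map u le_rfl)) := by
  intro h
  have h1 : ∀ i, ∃ j : Fin d, (ofLex (t i)).1 = (j : WithBot (Fin d)) := by
    intro i
    have hi := h i
    change cls s (WithBot.map u (ofLex (t i)).1) = _ at hi
    rcases hj : (ofLex (t i)).1 with _ | j
    · rw [hj] at hi
      exact absurd ((cls_bot s).symm.trans hi) (WithBot.bot_ne_coe)
    · exact ⟨j, rfl⟩
  choose j hj using h1
  have hinj : Function.Injective j := by
    intro i i' e
    have h2 := h i
    have h3 := h i'
    change cls s (WithBot.map u (ofLex (t i)).1) = _ at h2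
    change cls s (WithBot.map u (ofLex (t i')).1) = _ at h3
    rw [hj] at h2 h3
    rw [e] at h2
    exact WithBot.coe_injective (h2.symm.trans h3)
  simpa using Fintype.card_le_of_injective j hinj

lemma Transversal.le {t : Fin (d + 1) ↪o Fin k} {hl : 0 < l}
    (h : Transversal s (t.trans (Tm.top hl))) (i : Fin (d + 1)) : s i ≤ t i := by
  have := (h i).ge
  rw [coe_le_cls] at this
  exact WithBot.coe_le_coe.1 this

/-- A chain of `d + 1` points meeting all `d + 1` non-initial classes of `s` meets them in order,
once each, and is transversal. Otherwise it misses some class `i`, and its squeezed image lies over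
the face opposite to `i`. -/
lemma exists_face_of_not_transversal (hd : 0 < d + 1) (c : Fin (d + 1) ↪o Tm (Fin k) l)
    (h : ¬ Transversal s c) :
    ∃ (i : Fin (d + 1)) (t : Fin (d + 1) ↪o Tm (Fin d) (k * l)),
      t.trans (Tm.map (Fin.succAboveOrderEmb i) le_rfl) = c.trans (squeeze s hd l) := by
  obtain ⟨i, hi⟩ : ∃ i : Fin (d + 1), ∀ b, cls s (ofLex (c b)).1 ≠ (i : WithBot (Fin (d + 1))) := by
    by_contra! hcon
    apply h
    choose r hr using hcon
    have hmono : StrictMono r := by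
      intro i j hij
      by_contra! hle
      have h1 : cls s (ofLex (c (r j))).1 ≤ cls s (ofLex (c (r i))).1 :=
        cls_mono s (Prod.Lex.monotone_fst _ _ (c.monotone hle))
      rw [hr, hr, WithBot.coe_le_coe] at h1
      exact absurd hij h1.not_gt
    have hid : r = id := by
      have := Subsingleton.elim (α := Fin (d + 1) ≃o Fin (d + 1))
        (StrictMono.orderIsoOfSurjective r hmono (Finite.surjective_of_injective hmono.injective))
        (OrderIso.refl _)
      funext i
      exact DFunLike.congr_fun this i
    intro i
    have := hr i
    rwa [hid] at this
  refine ⟨i, exists_trans_eq _ _ fun b => ?_⟩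
  have hb := hi b
  have : ∃ j : WithBot (Fin d), WithBot.map i.succAbove j = cls s (ofLex (c b)).1 := by
    rcases hj : cls s (ofLex (c b)).1 with _ | j
    · exact ⟨⊥, rfl⟩
    · have hne : j ≠ i := fun e => hb (hj.trans (congrArg _ e))
      obtain ⟨j', rfl⟩ := Fin.exists_succAbove_eq hne
      exact ⟨(j' : WithBot (Fin d)), rfl⟩
  obtain ⟨j, hj⟩ := this
  exact ⟨toLex (j, (ofLex (squeeze s hd l (c b))).2), ofLex.injective (Prod.ext hj rfl)⟩

end Transversal

/-! ### Energy increment and replacement of indicators by conditional probabilities. -/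

section Independence

variable {Θ 𝒳 : Type*} [Fintype Θ] {w : Θ → ℝ} {d k n l W : ℕ}

/-- The initial chain. -/
abbrev initial {k n : ℕ} (h : k ≤ n) : Fin k ↪o Fin n := Fin.castLEOrderEmb h

/-- The data carried by the faces of the initial chain in a large template. -/
def initialBdry (hd : d + 1 ≤ n) (hl : l ≤ W) (x : Arr (d + 1) (Tm (Fin n) W) 𝒳) :
    Fin (d + 1) → Arr (d + 1) (Tm (Fin d) l) 𝒳 := bdry (initial hd) (lower hl x)

/-- The face data at a smaller scale is a restriction of that at a larger one; this is the nesting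
that Pythagoras requires. -/
lemma initialBdry_eq {l' : ℕ} (hd : d + 1 ≤ n) (hl : l ≤ l') (hl' : l' ≤ W)
    (x : Arr (d + 1) (Tm (Fin n) W) 𝒳) :
    initialBdry hd (hl.trans hl') x =
      fun i => (initialBdry hd hl' x i).pull (Tm.map (RelEmbedding.refl _) hl) := by
  funext i t
  have e := Tm.map_trans (RelEmbedding.refl _) (face (initial hd) i) hl hl'
  exact congrArg x (DFunLike.ext _ _ fun j => (DFunLike.congr_fun e (t j)).symm)

/-- Spreadability replaces the standard position by the squeezed one at cost `2 * η`. There `s`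
becomes the initial chain, so one conditional law `g` serves all `s`, and `h` becomes a function of
the face data at scale `k * l`; the energy gain bounds the rest. -/
lemma abs_ex_ind_sub_mul_le [Fintype 𝒳] (hw : IsWeight w)
    {X : Θ → Arr (d + 1) (Tm (Fin n) W) 𝒳} {η : ℝ}
    (hX : Spreads w X η) (hdk : d + 1 ≤ k) (hkn : k ≤ n) (hl : 0 < l) (hlW : k * l ≤ W)
    {g : (Fin (d + 1) → Arr (d + 1) (Tm (Fin d) l) 𝒳) → 𝒳 → ℝ}
    {g' : (Fin (d + 1) → Arr (d + 1) (Tm (Fin d) (k * l)) 𝒳) → 𝒳 → ℝ}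
    (hW : 0 < W) (hlW' : l ≤ W)
    (hg : IsCondDist w (fun θ => X θ ((initial (hdk.trans hkn)).trans (Tm.top hW)))
      (fun θ => initialBdry (hdk.trans hkn) hlW' (X θ)) g)
    (hg' : IsCondDist w (fun θ => X θ ((initial (hdk.trans hkn)).trans (Tm.top hW)))
      (fun θ => initialBdry (hdk.trans hkn) hlW (X θ)) g')
    (s : Fin (d + 1) ↪o Fin k) (a : 𝒳) (h : Arr (d + 1) (Tm (Fin k) l) 𝒳 → ℝ)
    (h1 : ∀ x, |h x| ≤ 1)
    (hh : ∀ x x', (∀ c, ¬ Transversal s c → x c = x' c) → h x = h x') :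
    |ex w fun θ => (ind ((X θ).pull (Tm.map (initial hkn) hlW') (s.trans (Tm.top hl))) a -
        g (bdry s (lower le_rfl ((X θ).pull (Tm.map (initial hkn) hlW')))) a) *
          h ((X θ).pull (Tm.map (initial hkn) hlW'))| ≤
      √(energy w (fun θ => initialBdry (hdk.trans hkn) hlW (X θ)) g' -
        energy w (fun θ => initialBdry (hdk.trans hkn) hlW' (X θ)) g) + 2 * η := by
  have hlk : l ≤ k * l := Nat.le_mul_of_pos_left l (by omega)
  let G : Arr (d + 1) (Tm (Fin k) l) 𝒳 → ℝ := fun x =>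
    (ind (x (s.trans (Tm.top hl))) a - g (bdry s (lower le_rfl x)) a) * h x
  have hG : ∀ x, |G x| ≤ 1 := by
    intro x
    simp only [G, abs_mul]
    refine mul_le_one₀ ?_ (abs_nonneg _) (h1 x)
    rw [abs_le]
    have := ind_nonneg (x (s.trans (Tm.top hl))) a
    have := ind_le_one (x (s.trans (Tm.top hl))) a
    have := hg.nonneg (bdry s (lower le_rfl x)) a
    have := hg.le_one (bdry s (lower le_rfl x)) a
    constructor <;> linarith
  let ψ : Tm (Fin k) l ↪o Tm (Fin n) W :=
    (squeeze s d.succ_pos l).trans (Tm.map (initial (hdk.trans hkn)) hlW)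
  have hψ : (Tm.map s le_rfl).trans ψ = Tm.map (initial (hdk.trans hkn)) hlW' := by
    have e1 := map_trans_squeeze s d.succ_pos l hlk
    have e2 := Tm.map_trans (RelEmbedding.refl _) (initial (hdk.trans hkn)) hlk hlW
    refine DFunLike.ext _ _ fun x => ?_
    have e3 := DFunLike.congr_fun e1 x
    have e4 := DFunLike.congr_fun e2 x
    exact (congrArg (Tm.map (initial (hdk.trans hkn)) hlW) e3).trans e4
  have hS := hX _ (Tm.map (initial hkn) hlW') ψ G hG
  have hpull : ∀ x : Arr (d + 1) (Tm (Fin n) W) 𝒳, (x.pull ψ).pull (Tm.map s le_rfl) =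
      x.pull (Tm.map (initial (hdk.trans hkn)) hlW') := by
    intro x
    rw [← hψ]
    rfl
  have hG2 : ∀ x : Arr (d + 1) (Tm (Fin n) W) 𝒳, G (x.pull ψ) =
      (ind (x ((initial (hdk.trans hkn)).trans (Tm.top hW))) a -
        g (initialBdry (hdk.trans hkn) hlW' x) a) * h (x.pull ψ) := by
    intro x
    have e1 : x.pull ψ (s.trans (Tm.top hl)) =
        x ((initial (hdk.trans hkn)).trans (Tm.top hW)) := by
      have := congrFun (hpull x) (Tm.top hl)
      exact this
    have e2 : bdry s (lower le_rfl (x.pull ψ)) = initialBdry (hdk.trans hkn) hlW' x := by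
      have := congrArg (fun y => bdry (RelEmbedding.refl _) (lower (le_refl l) y)) (hpull x)
      simp only [lower_pull] at this
      exact this
    simp only [G, e1, e2]
  have hmain := hg.abs_ex_sub_mul_le hw hg'
    (fun y i => (y i).pull (Tm.map (RelEmbedding.refl _) hlk))
    (fun θ => initialBdry_eq (hdk.trans hkn) hlk hlW (X θ)) a
    (fun θ => h ((X θ).pull ψ)) (fun θ => h1 _) (by
      intro θ θ' e
      apply hh
      intro c hc
      -- The squeezed chain lies in the block data of the `i`-th face, on which `θ` and `θ'` agree.
      obtain ⟨i, t, ht⟩ := exists_face_of_not_transversal s d.succ_pos c hc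
      have e1 : c.trans ψ = t.trans (Tm.map (face (initial (hdk.trans hkn)) i) hlW) := by
        have e2 : c.trans ψ = (c.trans (squeeze s d.succ_pos l)).trans
          (Tm.map (initial (hdk.trans hkn)) hlW) := rfl
        rw [e2, ← ht]
        have e3 := Tm.map_trans (Fin.succAboveOrderEmb i) (initial (hdk.trans hkn)) le_rfl hlW
        exact DFunLike.ext _ _ fun x => DFunLike.congr_fun e3 (t x)
      have e4 := congrFun (congrFun e i) t
      change X θ (c.trans ψ) = X θ' (c.trans ψ)
      rw [e1]
      exact e4)
  simp only [hG2] at hS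
  have := abs_sub_abs_le_abs_sub
    (ex w fun θ => G ((X θ).pull (Tm.map (initial hkn) hlW')))
    (ex w fun θ => (ind (X θ ((initial (hdk.trans hkn)).trans (Tm.top hW))) a -
        g (initialBdry (hdk.trans hkn) hlW' (X θ)) a) * h ((X θ).pull ψ))
  change |ex w fun θ => G ((X θ).pull (Tm.map (initial hkn) hlW'))| ≤ _
  linarith

/-- Replacing the indicators by their conditional expectations, one after the other. -/
lemma abs_ex_prod_sub_prod_le {x : Θ → Arr (d + 1) (Tm (Fin k) l) 𝒳}
    (hl : 0 < l) {g : (Fin (d + 1) → Arr (d + 1) (Tm (Fin d) l) 𝒳) → 𝒳 → ℝ}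
    (hg0 : ∀ y a, 0 ≤ g y a) (hg1 : ∀ y a, g y a ≤ 1) {δ : ℝ}
    (hδ : ∀ (s : Fin (d + 1) ↪o Fin k) (a : 𝒳) (h : Arr (d + 1) (Tm (Fin k) l) 𝒳 → ℝ),
      (∀ x, |h x| ≤ 1) → (∀ x x', (∀ c, ¬ Transversal s c → x c = x' c) → h x = h x') →
      |ex w fun θ => (ind (x θ (s.trans (Tm.top hl))) a - g (bdry s (lower le_rfl (x θ))) a) *
        h (x θ)| ≤ δ)
    (a : (Fin (d + 1) ↪o Fin k) → 𝒳) (F : Finset (Fin (d + 1) ↪o Fin k)) :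
    ∀ h₀ : Arr d (Fin k) (Arr (d + 1) (Tm (Fin d) l) 𝒳) → ℝ, (∀ y, |h₀ y| ≤ 1) →
    |(ex w fun θ => (∏ s ∈ F, ind (x θ (s.trans (Tm.top hl))) (a s)) * h₀ (lower le_rfl (x θ))) -
      ex w fun θ => (∏ s ∈ F, g (bdry s (lower le_rfl (x θ))) (a s)) *
        h₀ (lower le_rfl (x θ))| ≤ F.card * δ := by
  classical
  -- Chains are treated in order of coordinate sum. If `t` is transversal to `s` then `s ≤ t`
  -- pointwise, so when `s` has the largest sum no other `t ∈ F` is transversal to `s`.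
  refine Finset.induction_on_max_value
    (fun s : Fin (d + 1) ↪o Fin k => ∑ i, ((s i : Fin k) : ℕ)) F ?_ ?_
  · intro h₀ _; simp
  · intro s F hs hmax ih h₀ hh₀
    have hprod : ∀ y : Arr (d + 1) (Tm (Fin k) l) 𝒳,
        |∏ t ∈ F, ind (y (t.trans (Tm.top hl))) (a t)| ≤ 1 := by
      intro y
      rw [Finset.abs_prod]
      refine Finset.prod_le_one (fun _ _ => abs_nonneg _) fun t _ => ?_
      rw [abs_of_nonneg (ind_nonneg _ _)]
      exact ind_le_one _ _
    have h1 := hδ s (a s) (fun y => (∏ t ∈ F, ind (y (t.trans (Tm.top hl))) (a t)) *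
      h₀ (lower le_rfl y)) (fun y => by
        rw [abs_mul]
        exact mul_le_one₀ (hprod y) (abs_nonneg _) (hh₀ _)) (by
        intro y y' hy
        congr 1
        · refine Finset.prod_congr rfl fun t ht => ?_
          rw [hy]
          intro htr
          have hle : ∀ i, s i ≤ t i := htr.le
          have hsum := hmax t ht
          have : ∀ i, ((s i : Fin k) : ℕ) = (t i : ℕ) := by
            have := (Finset.sum_eq_sum_iff_of_le (s := Finset.univ)
              (f := fun i => ((s i : Fin k) : ℕ)) (g := fun i => ((t i : Fin k) : ℕ))
              (fun i _ => hle i)).1 (le_antisymm (Finset.sum_le_sum fun i _ => hle i) hsum)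
            exact fun i => this i (Finset.mem_univ i)
          have : s = t := DFunLike.ext _ _ fun i => Fin.ext (this i)
          exact hs (this ▸ ht)
        · congr 1
          funext u t
          exact hy _ (not_transversal_trans_map s u t))
    -- The factor `g` at `s` depends only on the block array, so it can be absorbed into `h₀`.
    have h2 := ih (fun y => g (bdry s y) (a s) * h₀ y) (fun y => by
      rw [abs_mul, abs_of_nonneg (hg0 _ _)]
      exact mul_le_one₀ (hg1 _ _) (abs_nonneg _) (hh₀ _))
    rw [Finset.card_insert_of_notMem hs]
    simp only [Finset.prod_insert hs, sub_mul, ex_sub] at h1 ⊢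
    have e1 : ∀ θ, ind (x θ (s.trans (Tm.top hl))) (a s) *
        (∏ t ∈ F, ind (x θ (t.trans (Tm.top hl))) (a t)) * h₀ (lower le_rfl (x θ)) =
        ind (x θ (s.trans (Tm.top hl))) (a s) *
        ((∏ t ∈ F, ind (x θ (t.trans (Tm.top hl))) (a t)) * h₀ (lower le_rfl (x θ))) :=
      fun θ => by ring
    have e2 : ∀ θ, (∏ t ∈ F, ind (x θ (t.trans (Tm.top hl))) (a t)) *
        (g (bdry s (lower le_rfl (x θ))) (a s) * h₀ (lower le_rfl (x θ))) =
        g (bdry s (lower le_rfl (x θ))) (a s) *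
        ((∏ t ∈ F, ind (x θ (t.trans (Tm.top hl))) (a t)) * h₀ (lower le_rfl (x θ))) :=
      fun θ => by ring
    have e3 : ∀ θ, (∏ t ∈ F, g (bdry t (lower le_rfl (x θ))) (a t)) *
        (g (bdry s (lower le_rfl (x θ))) (a s) * h₀ (lower le_rfl (x θ))) =
        g (bdry s (lower le_rfl (x θ))) (a s) *
        (∏ t ∈ F, g (bdry t (lower le_rfl (x θ))) (a t)) * h₀ (lower le_rfl (x θ)) :=
      fun θ => by ring
    simp only [e2, e3] at h2
    simp only [e1]
    rw [abs_le] at *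
    push_cast
    constructor <;> linarith [h1.1, h1.2, h2.1, h2.2]

end Independence

/-- A spreadable array has a scale at which its entries are nearly conditionally independent given
the lower-dimensional array of blocks. -/
lemma exists_scale {Θ 𝒳 : Type*} [Fintype Θ] [Fintype 𝒳] {w : Θ → ℝ} {d k n W J : ℕ}
    (hw : IsWeight w) {X : Θ → Arr (d + 1) (Tm (Fin n) W) 𝒳} {η ϑ : ℝ}
    (hX : Spreads w X η) (hdk : d + 1 ≤ k) (hkn : k ≤ n) (hJ : 1 < J * ϑ)
    (hJW : k ^ J ≤ W) (hW : 0 < W) :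
    ∃ (l : ℕ) (hlW : l ≤ W)
      (g : (Fin (d + 1) → Arr (d + 1) (Tm (Fin d) l) 𝒳) → 𝒳 → ℝ),
      k * l ≤ W ∧ (∀ y a, 0 ≤ g y a) ∧ (∀ y, ∑ a, g y a = 1) ∧
      ∀ (F : Finset (Fin (d + 1) ↪o Fin k)) (a : (Fin (d + 1) ↪o Fin k) → 𝒳),
        |(ex w fun θ => ∏ s ∈ F, ind (X θ (s.trans ((initial hkn).trans (Tm.top hW)))) (a s)) -
          ex w fun θ => ∏ s ∈ F, g (bdry s ((lower hlW (X θ)).pull (initial hkn))) (a s)| ≤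
        F.card * (√ϑ + 2 * η) := by
  classical
  have hk : 0 < k := by omega
  have hpow : ∀ i ≤ J, k ^ i ≤ W := fun i hi => (Nat.pow_le_pow_right hk hi).trans hJW
  choose! g hg using fun (l : ℕ) (hlW : l ≤ W) => hw.exists_isCondDist
    (fun θ => X θ ((initial (hdk.trans hkn)).trans (Tm.top hW)))
    (fun θ => initialBdry (hdk.trans hkn) hlW (X θ))
  let en : ℕ → ℝ := fun l => if h : l ≤ W then
    energy w (fun θ => initialBdry (hdk.trans hkn) h (X θ)) (g l) else 0
  have hen : ∀ l (h : l ≤ W), en l =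
    energy w (fun θ => initialBdry (hdk.trans hkn) h (X θ)) (g l) := fun l h => dif_pos h
  -- `J` consecutive increments above `ϑ` would push the energy beyond `J * ϑ > 1`.
  obtain ⟨i, hi, hinc⟩ : ∃ i < J, en (k ^ (i + 1)) - en (k ^ i) ≤ ϑ := by
    by_contra! hcon
    have hgrow : ∀ i ≤ J, i * ϑ ≤ en (k ^ i) := by
      intro i
      induction i with
      | zero =>
        intro _
        rw [hen _ (hpow 0 (Nat.zero_le _))]
        simpa using energy_nonneg hw _ _
      | succ i ih =>
        intro hi
        have h1 := ih (by omega)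
        have h2 := hcon i (by omega)
        push_cast
        linarith
    have h1 := hgrow J le_rfl
    rw [hen _ (hpow J le_rfl)] at h1
    linarith [(hg _ (hpow J le_rfl)).energy_le_one hw]
  have hl : 0 < k ^ i := Nat.pow_pos hk
  have hlW : k ^ i ≤ W := hpow i hi.le
  have hklW : k * k ^ i ≤ W := by rw [← pow_succ']; exact hpow (i + 1) hi
  rw [pow_succ', hen _ hklW, hen _ hlW] at hinc
  refine ⟨k ^ i, hlW, g (k ^ i), hklW, (hg _ hlW).nonneg, (hg _ hlW).sum_eq_one, ?_⟩
  intro F a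
  have h := abs_ex_prod_sub_prod_le (w := w)
    (x := fun θ => (X θ).pull (Tm.map (initial hkn) hlW)) hl (hg _ hlW).nonneg
    (hg _ hlW).le_one (δ := √ϑ + 2 * η) (fun s a h h1 h2 =>
      (abs_ex_ind_sub_mul_le hw hX hdk hkn hl hklW hW hlW (hg _ hlW) (hg _ hklW) s a h h1 h2).trans
        (by gcongr)) a F (fun _ => 1) (fun _ => by simp)
  simp only [mul_one, lower_pull] at h
  exact h

/-! ### Product weights -/

/-- The product of a family of weights. -/
def piW {κ Ω : Type*} [Fintype κ] (w : κ → Ω → ℝ) (ω : κ → Ω) : ℝ := ∏ i, w i (ω i)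

section piW

variable {κ Ω : Type*} [Fintype κ] [DecidableEq κ] [Fintype Ω] {w : κ → Ω → ℝ}

lemma ex_piW_prod (h : κ → Ω → ℝ) :
    (ex (piW w) fun ω => ∏ i, h i (ω i)) = ∏ i, ex (w i) (h i) := by
  simp only [ex, piW, ← Finset.prod_mul_distrib]
  rw [Finset.prod_univ_sum, Fintype.piFinset_univ]

lemma isWeight_piW (hw : ∀ i, IsWeight (w i)) : IsWeight (piW w) := by
  refine ⟨fun ω => Finset.prod_nonneg fun i _ => (hw i).nonneg _, ?_⟩
  have := ex_piW_prod (w := w) fun _ _ => 1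
  simpa [ex, fun i => (hw i).sum_eq_one] using this

/-- The expectation of a product of functions of distinct coordinates. -/
lemma ex_piW_prod_of_injOn {ι : Type*} (hw : ∀ i, IsWeight (w i)) (S : Finset ι) (z : ι → κ)
    (hz : Set.InjOn z S) (h : ι → Ω → ℝ) :
    (ex (piW w) fun ω => ∏ i ∈ S, h i (ω (z i))) = ∏ i ∈ S, ex (w (z i)) (h i) := by
  have e1 : ∀ ω : κ → Ω, ∏ i ∈ S, h i (ω (z i)) = ∏ y, ∏ i ∈ S with z i = y, h i (ω y) := by
    intro ω
    rw [← Finset.prod_fiberwise (s := S) (g := z)]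
    refine Finset.prod_congr rfl fun y _ => Finset.prod_congr rfl fun i hi => ?_
    rw [(Finset.mem_filter.1 hi).2]
  simp only [e1]
  rw [ex_piW_prod fun y x => ∏ i ∈ S with z i = y, h i x, ← Finset.prod_fiberwise (s := S) (g := z)]
  refine Finset.prod_congr rfl fun y _ => ?_
  rcases (S.filter fun i => z i = y).eq_empty_or_nonempty with h0 | ⟨i, hi⟩
  · rw [h0]
    simpa using (hw y).ex_const 1
  · have : (S.filter fun i => z i = y) = {i} := by
      refine Finset.eq_singleton_iff_unique_mem.2 ⟨hi, fun j hj => ?_⟩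
      rw [Finset.mem_filter] at hi hj
      exact hz hj.1 hi.1 (hj.2.trans hi.2.symm)
    simp only [this, Finset.prod_singleton]
    rw [(Finset.mem_filter.1 hi).2]

lemma ex_piW_apply (hw : ∀ i, IsWeight (w i)) (i : κ) (f : Ω → ℝ) :
    (ex (piW w) fun ω => f (ω i)) = ex (w i) f := by
  simpa using ex_piW_prod_of_injOn hw {i} id (by simp) (fun _ => f)

lemma ex_ind_left {w : Ω → ℝ} (a : Ω) : (ex w fun x => ind x a) = w a := by
  classical
  simp [ex, ind]

lemma ex_ind_right {w : Ω → ℝ} (a : Ω) : (ex w fun x => ind a x) = w a := by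
  classical
  simp [ex, ind]

lemma ex_piW_ind {w : Ω → ℝ} (hw : IsWeight w) {i j : κ} (hij : i ≠ j) :
    (ex (piW fun _ => w) fun ω : κ → Ω => ind (ω i) (ω j)) = ∑ x, w x ^ 2 := by
  have e1 : ∀ ω : κ → Ω, ind (ω i) (ω j) = ∑ x, ∏ t ∈ {i, j}, ind (ω t) x := by
    intro ω
    simp only [Finset.prod_pair hij]
    by_cases h : ω i = ω j
    · simp only [h, ind_mul_ind_self, sum_ind]
      simp [ind]
    · rw [Finset.sum_eq_zero]
      · simp [ind, h]
      · intro x _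
        by_cases h1 : ω i = x
        · have : ω j ≠ x := fun h2 => h (h1.trans h2.symm)
          simp [ind, this]
        · simp [ind, h1]
  simp only [e1]
  rw [ex_sum]
  refine Finset.sum_congr rfl fun x _ => ?_
  have := ex_piW_prod_of_injOn (w := fun _ : κ => w) (fun _ => hw) {i, j} id (by simp)
    (fun _ y => ind y x)
  simp only [id] at this
  rw [this, Finset.prod_pair hij, ex_ind_left, sq]

end piW

lemma ex_comm {Θ Ω : Type*} [Fintype Θ] [Fintype Ω] {w : Θ → ℝ} {u : Ω → ℝ} (f : Θ → Ω → ℝ) :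
    (ex w fun x => ex u fun y => f x y) = ex u fun y => ex w fun x => f x y := by
  simp only [ex, Finset.mul_sum]
  rw [Finset.sum_comm]
  exact Finset.sum_congr rfl fun _ _ => Finset.sum_congr rfl fun _ _ => by ring

lemma ex_mul_ex {Θ Ω : Type*} [Fintype Θ] [Fintype Ω] {w : Θ → ℝ} {u : Ω → ℝ} (f : Θ → ℝ)
    (g : Ω → ℝ) : ex w f * ex u g = ex w fun x => ex u fun y => f x * g y := by
  simp only [ex_const_mul]
  rw [mul_comm, ← ex_const_mul]
  exact congrArg _ (funext fun _ => mul_comm _ _)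

/-! ### Realizing a random colouring by a deterministic one -/

section Coloring

variable {Ω 𝒳 : Type*} [Fintype Ω] [Fintype 𝒳] {d k : ℕ}

lemma abs_prod_le_one {ι : Type*} (S : Finset ι) (f : ι → ℝ) (h0 : ∀ i, 0 ≤ f i)
    (h1 : ∀ i, f i ≤ 1) : |∏ i ∈ S, f i| ≤ 1 := by
  rw [abs_of_nonneg (Finset.prod_nonneg fun i _ => h0 i)]
  exact Finset.prod_le_one (fun i _ => h0 i) fun i _ => h1 i

lemma IsWeight.le_one {Θ : Type*} [Fintype Θ] {w : Θ → ℝ} (hw : IsWeight w) (x : Θ) : w x ≤ 1 := by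
  rw [← hw.sum_eq_one]
  exact Finset.single_le_sum (fun y _ => hw.nonneg y) (Finset.mem_univ x)

/-- The density of a pattern in a colouring and its expected value: the mean square of the
difference is small. -/
lemma ex_sq_density_sub_le {w : Ω → ℝ} (hw : IsWeight w) (hd : 0 < d)
    {p : (Fin d → Ω) → 𝒳 → ℝ} (hp : ∀ z, IsWeight (p z)) (F : Finset (Fin d ↪o Fin k))
    (a : (Fin d ↪o Fin k) → 𝒳) :
    open Classical in
    (ex (piW p) fun e =>
      ((ex (piW fun _ => w) fun ω : Fin k → Ω => ∏ s ∈ F, ind (e (ω ∘ s)) (a s)) -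
      ex (piW fun _ => w) fun ω : Fin k → Ω => ∏ s ∈ F, p (ω ∘ s) (a s)) ^ 2) ≤
    3 * k ^ 2 * ∑ x, w x ^ 2 := by
  classical
  have hW : IsWeight (piW fun _ : Fin k => w) := isWeight_piW fun _ => hw
  have hP : IsWeight (piW p) := isWeight_piW hp
  let D : ((Fin d → Ω) → 𝒳) → (Fin k → Ω) → ℝ := fun e ω =>
    ∏ s ∈ F, ind (e (ω ∘ s)) (a s) - ∏ s ∈ F, p (ω ∘ s) (a s)
  have hD : ∀ e ω, |D e ω| ≤ 1 := by
    intro e ω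
    have h1 : 0 ≤ ∏ s ∈ F, ind (e (ω ∘ s)) (a s) := Finset.prod_nonneg fun _ _ => ind_nonneg _ _
    have h2 : 0 ≤ ∏ s ∈ F, p (ω ∘ s) (a s) := Finset.prod_nonneg fun _ _ => (hp _).nonneg _
    have h3 := le_of_abs_le (abs_prod_le_one F (fun s => ind (e (ω ∘ s)) (a s))
      (fun _ => ind_nonneg _ _) fun _ => ind_le_one _ _)
    have h4 := le_of_abs_le (abs_prod_le_one F (fun s => p (ω ∘ s) (a s))
      (fun _ => (hp _).nonneg _) fun _ => (hp _).le_one _)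
    rw [abs_le]
    constructor <;> simp only [D] <;> linarith
  -- The square is written with two independent copies `ω`, `ω'` of the vertex sample, and the
  -- colouring is averaged first.
  have e1 : ∀ e, ((ex (piW fun _ => w) fun ω : Fin k → Ω => ∏ s ∈ F, ind (e (ω ∘ s)) (a s)) -
      ex (piW fun _ => w) fun ω : Fin k → Ω => ∏ s ∈ F, p (ω ∘ s) (a s)) ^ 2 =
      ex (piW fun _ => w) fun ω : Fin k → Ω => ex (piW fun _ => w) fun ω' : Fin k → Ω =>
        D e ω * D e ω' := by
    intro e
    rw [← ex_sub, sq, ex_mul_ex]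
  simp only [e1]
  rw [ex_comm]
  have e2 : ∀ ω : Fin k → Ω, (ex (piW p) fun e => ex (piW fun _ => w) fun ω' : Fin k → Ω =>
      D e ω * D e ω') = ex (piW fun _ => w) fun ω' : Fin k → Ω => ex (piW p) fun e =>
        D e ω * D e ω' := fun ω => ex_comm _
  simp only [e2]
  have hone : ∀ ω : Fin k → Ω, Function.Injective ω →
      (ex (piW p) fun e => ∏ s ∈ F, ind (e (ω ∘ s)) (a s)) = ∏ s ∈ F, p (ω ∘ s) (a s) := by
    intro ω hω
    have := ex_piW_prod_of_injOn hp F (fun s : Fin d ↪o Fin k => ω ∘ s) (by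
      intro s _ s' _ h
      exact DFunLike.coe_injective (hω.comp_left h)) (fun s x => ind x (a s))
    rw [this]
    simp only [ex_ind_left]
  -- When all `2k` vertices are distinct, the tuples involved are distinct, so their colours are
  -- independent and the covariance vanishes.
  have hcov : ∀ ω ω' : Fin k → Ω, Function.Injective ω → Function.Injective ω' →
      (∀ i j, ω i ≠ ω' j) → (ex (piW p) fun e => D e ω * D e ω') = 0 := by
    intro ω ω' hω hω' hne
    have htwo : (ex (piW p) fun e => (∏ s ∈ F, ind (e (ω ∘ s)) (a s)) *
        ∏ s ∈ F, ind (e (ω' ∘ s)) (a s)) =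
        (∏ s ∈ F, p (ω ∘ s) (a s)) * ∏ s ∈ F, p (ω' ∘ s) (a s) := by
      have := ex_piW_prod_of_injOn hp (F.disjSum F)
        (Sum.elim (fun s : Fin d ↪o Fin k => ω ∘ s) fun s : Fin d ↪o Fin k => ω' ∘ s) (by
          rintro (s | s) _ (s' | s') _ h
          · exact congrArg _ (DFunLike.coe_injective (hω.comp_left h))
          -- Since `0 < d`, tuples with disjoint sets of values differ.
          · exact absurd (congrFun h ⟨0, hd⟩) (hne _ _)
          · exact absurd (congrFun h ⟨0, hd⟩) (hne _ _).symm
          · exact congrArg _ (DFunLike.coe_injective (hω'.comp_left h)))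
        (Sum.elim (fun s x => ind x (a s)) fun s x => ind x (a s))
      simp only [Finset.prod_disjSum, Sum.elim_inl, Sum.elim_inr, ex_ind_left] at this
      exact this
    have e3 : ∀ e, D e ω * D e ω' = (∏ s ∈ F, ind (e (ω ∘ s)) (a s)) *
        (∏ s ∈ F, ind (e (ω' ∘ s)) (a s)) -
        (∏ s ∈ F, p (ω ∘ s) (a s)) * (∏ s ∈ F, ind (e (ω' ∘ s)) (a s)) -
        (∏ s ∈ F, p (ω' ∘ s) (a s)) * (∏ s ∈ F, ind (e (ω ∘ s)) (a s)) +
        (∏ s ∈ F, p (ω ∘ s) (a s)) * ∏ s ∈ F, p (ω' ∘ s) (a s) := fun e => by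
      simp only [D]; ring
    simp only [e3]
    rw [ex_add, ex_sub, ex_sub, htwo, ex_const_mul, ex_const_mul, hone _ hω, hone _ hω',
      hP.ex_const]
    ring
  -- A count of coincidences within `ω`, within `ω'` and between them; each has probability `∑ x, w
  -- x ^ 2`.
  let C : (Fin k → Ω) → (Fin k → Ω) → ℝ := fun ω ω' =>
    ∑ i, ∑ j, ((if i = j then 0 else ind (ω i) (ω j)) + (if i = j then 0 else ind (ω' i) (ω' j)) +
      ind (ω i) (ω' j))
  have hC0 : ∀ (ω ω' : Fin k → Ω) (i j : Fin k), 0 ≤ (if i = j then 0 else ind (ω i) (ω j)) +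
      (if i = j then 0 else ind (ω' i) (ω' j)) + ind (ω i) (ω' j) := by
    intro ω ω' i j
    have := ind_nonneg (ω i) (ω j)
    have := ind_nonneg (ω' i) (ω' j)
    have := ind_nonneg (ω i) (ω' j)
    split_ifs <;> linarith
  have hCge : ∀ (ω ω' : Fin k → Ω) (i j : Fin k), (if i = j then 0 else ind (ω i) (ω j)) +
      (if i = j then 0 else ind (ω' i) (ω' j)) + ind (ω i) (ω' j) ≤ C ω ω' := by
    intro ω ω' i j
    refine le_trans ?_ (Finset.single_le_sum (fun i _ => Finset.sum_nonneg fun j _ => hC0 ω ω' i j)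
      (Finset.mem_univ i))
    exact Finset.single_le_sum (fun j _ => hC0 ω ω' i j) (Finset.mem_univ j)
  have hbound : ∀ ω ω' : Fin k → Ω, (ex (piW p) fun e => D e ω * D e ω') ≤ C ω ω' := by
    intro ω ω'
    have hle : (ex (piW p) fun e => D e ω * D e ω') ≤ 1 := le_of_abs_le (hP.abs_ex_le fun e => by
      rw [abs_mul]; exact mul_le_one₀ (hD e ω) (abs_nonneg _) (hD e ω'))
    by_cases h1 : Function.Injective ω
    · by_cases h2 : Function.Injective ω'
      · by_cases h3 : ∀ i j, ω i ≠ ω' j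
        · rw [hcov ω ω' h1 h2 h3]
          exact Finset.sum_nonneg fun i _ => Finset.sum_nonneg fun j _ => hC0 ω ω' i j
        · push Not at h3
          obtain ⟨i, j, hij⟩ := h3
          refine hle.trans (le_trans ?_ (hCge ω ω' i j))
          have := ind_nonneg (ω i) (ω j)
          have := ind_nonneg (ω' i) (ω' j)
          have : ind (ω i) (ω' j) = 1 := by simp [ind, hij]
          split_ifs <;> linarith
      · simp only [Function.Injective] at h2
        push Not at h2
        obtain ⟨i, j, hij, hne⟩ := h2
        refine hle.trans (le_trans ?_ (hCge ω ω' i j))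
        have := ind_nonneg (ω i) (ω j)
        have := ind_nonneg (ω i) (ω' j)
        have : ind (ω' i) (ω' j) = 1 := by simp [ind, hij]
        rw [if_neg hne, if_neg hne]
        linarith
    · simp only [Function.Injective] at h1
      push Not at h1
      obtain ⟨i, j, hij, hne⟩ := h1
      refine hle.trans (le_trans ?_ (hCge ω ω' i j))
      have := ind_nonneg (ω' i) (ω' j)
      have := ind_nonneg (ω i) (ω' j)
      have : ind (ω i) (ω j) = 1 := by simp [ind, hij]
      rw [if_neg hne, if_neg hne]
      linarith
  refine (hW.ex_mono fun ω => hW.ex_mono fun ω' => hbound ω ω').trans ?_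
  have hq : 0 ≤ ∑ x, w x ^ 2 := Finset.sum_nonneg fun _ _ => sq_nonneg _
  have hterm : ∀ i j : Fin k, (ex (piW fun _ => w) fun ω : Fin k → Ω =>
      ex (piW fun _ => w) fun ω' : Fin k → Ω => (if i = j then 0 else ind (ω i) (ω j)) +
      (if i = j then 0 else ind (ω' i) (ω' j)) + ind (ω i) (ω' j)) ≤ 3 * ∑ x, w x ^ 2 := by
    intro i j
    have h3 : (ex (piW fun _ => w) fun ω : Fin k → Ω =>
        ex (piW fun _ => w) fun ω' : Fin k → Ω => ind (ω i) (ω' j)) = ∑ x, w x ^ 2 := by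
      have e4 : ∀ ω : Fin k → Ω, (ex (piW fun _ => w) fun ω' : Fin k → Ω => ind (ω i) (ω' j)) =
          w (ω i) := fun ω => by
        rw [ex_piW_apply (fun _ => hw) j fun y => ind (ω i) y, ex_ind_right]
      simp only [e4]
      rw [ex_piW_apply (fun _ => hw) i w]
      exact Finset.sum_congr rfl fun x _ => (sq _).symm
    by_cases hij : i = j
    · simp only [hij, if_true, zero_add]
      rw [hij] at h3
      rw [h3]
      linarith
    · simp only [if_neg hij, ex_add, hW.ex_const, h3, ex_piW_ind hw hij]
      linarith
  simp only [C, ex_sum]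
  refine (Finset.sum_le_sum fun i _ => Finset.sum_le_sum fun j _ => hterm i j).trans ?_
  simp only [Finset.sum_const, Finset.card_univ, Fintype.card_fin, nsmul_eq_mul]
  exact le_of_eq (by ring)

lemma IsWeight.exists_le_ex {Θ : Type*} [Fintype Θ] {w : Θ → ℝ} (hw : IsWeight w) (f : Θ → ℝ) :
    ∃ x, f x ≤ ex w f := by
  by_contra! h
  have h1 : ∀ x, w x * ex w f ≤ w x * f x := fun x =>
    mul_le_mul_of_nonneg_left (h x).le (hw.nonneg x)
  have h2 : ∃ x, w x ≠ 0 := by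
    by_contra! h0
    simpa [h0] using hw.sum_eq_one
  obtain ⟨x, hx⟩ := h2
  have h3 : ∑ x, w x * ex w f < ∑ x, w x * f x := Finset.sum_lt_sum (fun x _ => h1 x)
    ⟨x, Finset.mem_univ x, mul_lt_mul_of_pos_left (h x) (lt_of_le_of_ne (hw.nonneg x) hx.symm)⟩
  rw [← Finset.sum_mul, hw.sum_eq_one, one_mul] at h3
  exact lt_irrefl _ h3

/-- There is a colouring in which all patterns have approximately their expected densities. -/
lemma exists_coloring {w : Ω → ℝ} (hw : IsWeight w) (hd : 0 < d)
    {p : (Fin d → Ω) → 𝒳 → ℝ} (hp : ∀ z, IsWeight (p z)) {δ : ℝ} (hδ : 0 ≤ δ)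
    (h : (2 * Fintype.card 𝒳 : ℝ) ^ (Fintype.card (Fin d ↪o Fin k)) *
      (3 * k ^ 2 * ∑ x, w x ^ 2) ≤ δ ^ 2) :
    ∃ e : (Fin d → Ω) → 𝒳, ∀ (F : Finset (Fin d ↪o Fin k)) (a : (Fin d ↪o Fin k) → 𝒳),
      |(ex (piW fun _ => w) fun ω : Fin k → Ω => ∏ s ∈ F, ind (e (ω ∘ s)) (a s)) -
        ex (piW fun _ => w) fun ω : Fin k → Ω => ∏ s ∈ F, p (ω ∘ s) (a s)| ≤ δ := by
  classical
  have hP : IsWeight (piW p) := isWeight_piW hp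
  -- Averaging the total squared error over all pairs `(F, a)` gives one colouring good for every
  -- pattern; with `c` chains there are `2 ^ c * card 𝒳 ^ c` pairs.
  obtain ⟨e, he⟩ := hP.exists_le_ex fun e =>
    ∑ q : Finset (Fin d ↪o Fin k) × ((Fin d ↪o Fin k) → 𝒳),
      ((ex (piW fun _ => w) fun ω : Fin k → Ω => ∏ s ∈ q.1, ind (e (ω ∘ s)) (q.2 s)) -
        ex (piW fun _ => w) fun ω : Fin k → Ω => ∏ s ∈ q.1, p (ω ∘ s) (q.2 s)) ^ 2
  refine ⟨e, fun F a => abs_le_of_sq_le_sq ?_ hδ⟩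
  have h1 := Finset.single_le_sum (f := fun q : Finset (Fin d ↪o Fin k) × ((Fin d ↪o Fin k) → 𝒳) =>
    ((ex (piW fun _ => w) fun ω : Fin k → Ω => ∏ s ∈ q.1, ind (e (ω ∘ s)) (q.2 s)) -
        ex (piW fun _ => w) fun ω : Fin k → Ω => ∏ s ∈ q.1, p (ω ∘ s) (q.2 s)) ^ 2)
    (fun _ _ => sq_nonneg _) (Finset.mem_univ (F, a))
  refine h1.trans (he.trans (le_trans ?_ h))
  rw [ex_sum]
  refine (Finset.sum_le_sum fun q _ => ex_sq_density_sub_le hw hd hp q.1 q.2).trans ?_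
  rw [Finset.sum_const, nsmul_eq_mul, Finset.card_univ, Fintype.card_prod, Fintype.card_finset,
    Fintype.card_fun]
  push_cast
  rw [mul_pow]

end Coloring

/-! ### Models built from independent vertex variables -/

lemma prod_ind_eq {ι α : Type*} [Fintype ι] (f g : ι → α) : ∏ i, ind (f i) (g i) = ind f g := by
  classical
  by_cases h : f = g
  · simp [h, ind]
  · obtain ⟨i, hi⟩ := Function.ne_iff.1 h
    rw [Finset.prod_eq_zero (Finset.mem_univ i) (by simp [ind, hi])]
    simp [ind, h]

lemma ex_comp {Ω Ω' : Type*} [Fintype Ω] [Fintype Ω'] {w : Ω → ℝ} {w' : Ω' → ℝ} {π : Ω → Ω'}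
    (hπ : ∀ y, (ex w fun x => ind (π x) y) = w' y) (f : Ω' → ℝ) :
    (ex w fun x => f (π x)) = ex w' f := by
  rw [ex_eq_sum_ind π]
  refine Finset.sum_congr rfl fun y _ => ?_
  rw [← hπ y, mul_comm, ← ex_const_mul]
  congr 1
  funext x
  by_cases h : π x = y
  · simp [ind, h]
  · simp [ind, h]

lemma ex_piW_comp {κ Ω Ω' : Type*} [Fintype κ] [DecidableEq κ] [Fintype Ω] [Fintype Ω']
    {w : Ω → ℝ} {w' : Ω' → ℝ} {π : Ω → Ω'}
    (hπ : ∀ y, (ex w fun x => ind (π x) y) = w' y) (f : (κ → Ω') → ℝ) :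
    (ex (piW fun _ => w) fun ω : κ → Ω => f (π ∘ ω)) = ex (piW fun _ => w') f := by
  refine ex_comp (fun y => ?_) f
  simp only [← prod_ind_eq, Function.comp]
  rw [ex_piW_prod fun i x => ind (π x) (y i)]
  simp only [hπ, piW]

/-- The expectation of a function of the array on `Fin k` with entries `e ω₀ (ω ∘ s)`, where `ω₀`
and the coordinates of `ω` are independent. -/
def modelEx {Ω 𝒳 : Type*} [Fintype Ω] {d k : ℕ} (w : Ω → ℝ) (e : Ω → (Fin d → Ω) → 𝒳)
    (H : Arr d (Fin k) 𝒳 → ℝ) : ℝ :=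
  ex w fun ω₀ => ex (piW fun _ => w) fun ω : Fin k → Ω => H fun s => e ω₀ (ω ∘ s)

/-- The indicator of the pattern `a` on `F`. -/
def pat {ι 𝒳 : Type*} (F : Finset ι) (a y : ι → 𝒳) : ℝ := ∏ s ∈ F, ind (y s) (a s)

/-- A function on a finite set is a combination of point indicators, which are the full patterns;
the loss is the number of arrays. The power of `mbar` in `epsbar` compensates for this. -/
lemma abs_ex_sub_modelEx_le {Θ Ω 𝒳 : Type*} [Fintype Θ] [Fintype Ω] [Fintype 𝒳] {d k : ℕ}
    {w : Θ → ℝ} {w' : Ω → ℝ} {e : Ω → (Fin d → Ω) → 𝒳} {Y : Θ → Arr d (Fin k) 𝒳} {δ : ℝ}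
    (h : ∀ a, |(ex w fun θ => pat Finset.univ a (Y θ)) - modelEx w' e (pat Finset.univ a)| ≤ δ)
    (H : Arr d (Fin k) 𝒳 → ℝ) (hH : ∀ y, |H y| ≤ 1) :
    |(ex w fun θ => H (Y θ)) - modelEx w' e H| ≤
      (Fintype.card 𝒳 : ℝ) ^ Fintype.card (Fin d ↪o Fin k) * δ := by
  classical
  have e1 : ∀ y, H y = ∑ a, H a * pat Finset.univ a y := by
    intro y
    have e0 : ∀ a, pat Finset.univ a y = ind y a := fun a => prod_ind_eq y a
    simp only [e0, ind]
    simp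
  have e2 : (ex w fun θ => H (Y θ)) = ∑ a, H a * ex w fun θ => pat Finset.univ a (Y θ) := by
    simp only [← ex_const_mul]
    rw [← ex_sum]
    exact congrArg _ (funext fun θ => e1 _)
  have e3 : modelEx w' e H = ∑ a, H a * modelEx w' e (pat Finset.univ a) := by
    simp only [modelEx, ← ex_const_mul]
    simp only [← ex_sum]
    exact congrArg _ (funext fun ω₀ => congrArg _ (funext fun ω => e1 _))
  rw [e2, e3, ← Finset.sum_sub_distrib]
  refine (Finset.abs_sum_le_sum_abs _ _).trans ?_
  have : ∀ a ∈ Finset.univ, |(H a * ex w fun θ => pat Finset.univ a (Y θ)) -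
      H a * modelEx w' e (pat Finset.univ a)| ≤ δ := by
    intro a _
    rw [← mul_sub, abs_mul]
    calc _ ≤ 1 * |(ex w fun θ => pat Finset.univ a (Y θ)) - modelEx w' e (pat Finset.univ a)| :=
          mul_le_mul_of_nonneg_right (hH a) (abs_nonneg _)
      _ ≤ δ := by rw [one_mul]; exact h a
  refine (Finset.sum_le_sum this).trans ?_
  rw [Finset.sum_const, nsmul_eq_mul, Finset.card_univ, Fintype.card_fun]
  push_cast
  rfl

/-- The weights on `Ω × Fin N` whose second marginal is uniform. -/
def blowUp {Ω : Type*} (w : Ω → ℝ) (N : ℕ) (x : Ω × Fin N) : ℝ := w x.1 / N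

lemma ex_blowUp {Ω : Type*} [Fintype Ω] {w : Ω → ℝ} {N : ℕ} (hN : 0 < N) (y : Ω) :
    (ex (blowUp w N) fun x => ind x.1 y) = w y := by
  classical
  have : (N : ℝ) ≠ 0 := by positivity
  simp only [ex, blowUp, ind, Fintype.sum_prod_type, mul_ite, mul_one, mul_zero, Finset.sum_const,
    Finset.card_univ, Fintype.card_fin, nsmul_eq_mul]
  simp only [Finset.sum_ite_eq', Finset.mem_univ, if_true]
  field_simp

lemma isWeight_blowUp {Ω : Type*} [Fintype Ω] {w : Ω → ℝ} (hw : IsWeight w) {N : ℕ} (hN : 0 < N) :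
    IsWeight (blowUp w N) := by
  refine ⟨fun x => div_nonneg (hw.nonneg _) (Nat.cast_nonneg _), ?_⟩
  have := ex_comp (ex_blowUp (w := w) hN) fun _ => 1
  simpa [ex, hw.sum_eq_one] using this

/-- Every point has mass at most `1 / N`, and the masses add up to one. -/
lemma sum_blowUp_sq_le {Ω : Type*} [Fintype Ω] {w : Ω → ℝ} (hw : IsWeight w) {N : ℕ} (hN : 0 < N) :
    ∑ x, blowUp w N x ^ 2 ≤ 1 / N := by
  have hN' : (0 : ℝ) < N := by positivity
  have h1 : ∑ x, blowUp w N x ^ 2 ≤ ∑ x, blowUp w N x * (1 / N) := by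
    refine Finset.sum_le_sum fun x _ => ?_
    have h0 := (isWeight_blowUp hw hN).nonneg x
    rw [sq]
    refine mul_le_mul_of_nonneg_left ?_ h0
    unfold blowUp
    have := hw.le_one x.1
    gcongr
  rwa [← Finset.sum_mul, (isWeight_blowUp hw hN).sum_eq_one, one_mul] at h1

/-- From a model of the lower-dimensional array, and conditional probabilities `g` for the entries
of the array given the lower-dimensional array, one obtains a model of the array. -/
lemma exists_model_of_condProb {Ω 𝒳 𝒴 : Type*} [Fintype Ω] [Fintype 𝒳] {d k N : ℕ} {w : Ω → ℝ}
    (hw : IsWeight w) (e' : Ω → (Fin d → Ω) → 𝒴) {g : (Fin (d + 1) → 𝒴) → 𝒳 → ℝ}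
    (hg : ∀ y, IsWeight (g y)) (hN : 0 < N) {δ : ℝ} (hδ : 0 ≤ δ)
    (h : (2 * Fintype.card 𝒳 : ℝ) ^ (Fintype.card (Fin (d + 1) ↪o Fin k)) *
      (3 * k ^ 2 * (1 / N)) ≤ δ ^ 2) :
    ∃ e : Ω × Fin N → (Fin (d + 1) → Ω × Fin N) → 𝒳,
      ∀ (F : Finset (Fin (d + 1) ↪o Fin k)) (a : (Fin (d + 1) ↪o Fin k) → 𝒳),
        |modelEx (blowUp w N) e (pat F a) -
          modelEx w e' fun y => ∏ s ∈ F, g (bdry s y) (a s)| ≤ δ := by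
  have hw2 := isWeight_blowUp hw hN
  -- A separate colouring is chosen for each `ω₀`. A tuple receives the conditional law determined
  -- by the model values on its `d + 1` faces.
  have hcol := fun ω₀ : Ω => exists_coloring (k := k) hw2 d.succ_pos
    (p := fun z => g fun i => e' ω₀ fun j => (z (i.succAbove j)).1) (fun _ => hg _) hδ
    (le_trans (by have := sum_blowUp_sq_le hw hN; gcongr) h)
  choose e he using hcol
  refine ⟨fun ω₀ => e ω₀.1, fun F a => ?_⟩
  have e1 : modelEx w e' (fun y => ∏ s ∈ F, g (bdry s y) (a s)) = ex (blowUp w N) fun ω₀ =>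
      ex (piW fun _ => blowUp w N) fun ω : Fin k → Ω × Fin N =>
        ∏ s ∈ F, g (fun i => e' ω₀.1 fun j => ((ω ∘ s) (i.succAbove j)).1) (a s) := by
    unfold modelEx
    rw [← ex_comp (ex_blowUp (w := w) hN)]
    congr 1
    funext ω₀
    rw [← ex_piW_comp (ex_blowUp (w := w) hN)]
    rfl
  rw [e1, modelEx, ← ex_sub]
  exact hw2.abs_ex_le fun ω₀ => he ω₀.1 F a

/-! ### The step from the lower-dimensional array to the array -/

/-- A template over `Fin n` fits into a long enough interval. -/
def Tm.toFin {n W p : ℕ} (h : W * (n + 1) ≤ p) : Tm (Fin n) W ↪o Fin p :=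
  OrderEmbedding.ofStrictMono (fun x => ⟨code (ofLex x).1 * W + (ofLex x).2, by
      have h1 := code_le (ofLex x).1
      have h2 := (ofLex x).2.2
      nlinarith⟩) (by
    intro x y hxy
    rw [Tm.lt_iff] at hxy
    simp only [Fin.mk_lt_mk]
    rcases hxy with h | ⟨h1, h2⟩
    · have h3 := code_strictMono h
      have h4 := (ofLex x).2.2
      nlinarith
    · rw [h1]
      simpa using h2)

lemma abs_pat_le_one {ι 𝒳 : Type*} (F : Finset ι) (a y : ι → 𝒳) : |pat F a y| ≤ 1 :=
  abs_prod_le_one F _ (fun _ => ind_nonneg _ _) fun _ => ind_le_one _ _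

lemma card_chain_fin_le (d k : ℕ) : Fintype.card (Fin d ↪o Fin k) ≤ k ^ d := by
  simpa using card_chain_le (d := d) (A := Fin k)

lemma theta_pos {d k : ℕ} {ε : ℝ} (hk : 0 < k) (hε : 0 < ε) : 0 < theta d k ε := by
  unfold theta; positivity

lemma one_div_theta_ge {d k : ℕ} {ε : ℝ} (hk : 0 < k) (hε : 0 < ε) (hε1 : ε ≤ 1) :
    128 * (k : ℝ) ^ (2 * d) ≤ 1 / theta d k ε := by
  unfold theta
  rw [one_div_div, le_div_iff₀ (by positivity)]
  have : ε ^ 2 ≤ 1 := pow_le_one₀ hε.le hε1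
  have h2 : (0 : ℝ) ≤ 2 ^ 7 * (k : ℝ) ^ (2 * d) := by positivity
  nlinarith

/-- The factor `m ≥ 2` makes up for the loss in the floor, so the exponent in `ell0` provides enough
scales. -/
lemma one_lt_mul_theta {d m k : ℕ} {ε : ℝ} (hk : 0 < k) (hm : 2 ≤ m) (hε : 0 < ε) (hε1 : ε ≤ 1) :
    1 < ((m * ⌊1 / theta d k ε⌋₊ : ℕ) : ℝ) * theta d k ε := by
  have h0 := theta_pos (d := d) hk hε
  have h1 := one_div_theta_ge (d := d) hk hε hε1
  have h2 : (1 : ℝ) ≤ (k : ℝ) ^ (2 * d) := one_le_pow₀ (by exact_mod_cast hk)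
  have h3 := Nat.lt_floor_add_one (1 / theta d k ε)
  have h4 : (2 : ℝ) ≤ m := by exact_mod_cast hm
  have h5 : 1 / theta d k ε < m * (⌊1 / theta d k ε⌋₊ : ℝ) := by nlinarith
  rw [div_lt_iff₀ h0] at h5
  push_cast
  exact h5

lemma sqrt_theta_le {d k : ℕ} {ε : ℝ} (hk : 0 < k) (hε : 0 < ε) :
    √(theta d k ε) ≤ ε / (8 * k ^ d) := by
  apply Real.sqrt_le_iff.2
  refine ⟨by positivity, ?_⟩
  unfold theta
  rw [div_pow, mul_pow, ← pow_mul, mul_comm d 2]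
  gcongr
  norm_num

lemma ell0_pos {d m k : ℕ} {ε : ℝ} (hk : 0 < k) : 0 < ell0 d m k ε := Nat.pow_pos hk

/-- The inductive step, with the model of the block array left as a hypothesis. It thus covers both
block arrays of dimension 0 and those supplied by induction. -/
lemma exists_model_of_lower {Θ : Type*} {𝒳 : Type} [Fintype Θ] [Fintype 𝒳] {w : Θ → ℝ}
    {d k m n n' : ℕ} {ε η B : ℝ} (hdk : d + 1 ≤ k) (hm : 2 ≤ m) (hε : 0 < ε) (hε1 : ε ≤ 1)
    (hcard : Fintype.card 𝒳 ≤ m) (hkn : k ≤ n') (hn : ell0 (d + 1) m k ε * (n' + 1) ≤ n)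
    (hw : IsWeight w) {X : Θ → Arr (d + 1) (Fin n) 𝒳} (hX : Spreads w X η)
    (hη : η ≤ ε / (32 * k ^ (d + 1)))
    (hlow : ∀ l, k * l ≤ ell0 (d + 1) m k ε →
      ∀ Y : Θ → Arr d (Fin n') (Arr (d + 1) (Tm (Fin d) l) 𝒳), Spreads w Y η →
      ∃ (Ω : Type) (_ : Fintype Ω) (w' : Ω → ℝ)
        (e : Ω → (Fin d → Ω) → Arr (d + 1) (Tm (Fin d) l) 𝒳), IsWeight w' ∧
        (Fintype.card Ω : ℝ) ≤ B ∧ ∀ H : Arr d (Fin k) (Arr (d + 1) (Tm (Fin d) l) 𝒳) → ℝ,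
          (∀ y, |H y| ≤ 1) →
          |(ex w fun θ => H ((Y θ).pull (initial hkn))) - modelEx w' e H| ≤ ε / 8) :
    ∃ (Ω : Type) (_ : Fintype Ω) (w' : Ω → ℝ) (e : Ω → (Fin (d + 1) → Ω) → 𝒳), IsWeight w' ∧
      (Fintype.card Ω : ℝ) ≤ B * (32 * k ^ 2 * (ε ^ 2)⁻¹ * m ^ (2 * k ^ (d + 1))) ∧
      ∀ (ι : Fin k ↪o Fin n) (F : Finset (Fin (d + 1) ↪o Fin k))
        (a : (Fin (d + 1) ↪o Fin k) → 𝒳),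
        |(ex w fun θ => pat F a ((X θ).pull ι)) - modelEx w' e (pat F a)| ≤ ε := by
  classical
  have hk : 0 < k := by omega
  have hkR : (1 : ℝ) ≤ k := by exact_mod_cast hk
  have hmR : (1 : ℝ) ≤ m := by exact_mod_cast (by omega : 1 ≤ m)
  set W := ell0 (d + 1) m k ε with hWdef
  have hW : 0 < W := ell0_pos hk
  obtain ⟨l, hlW, g, hklW, hg0, hg1, hg⟩ := exists_scale (J := m * ⌊1 / theta (d + 1) k ε⌋₊)
    hw (hX.pull (Tm.toFin hn)) hdk hkn (one_lt_mul_theta hk hm hε hε1) le_rfl hW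
  obtain ⟨Ω, hΩ, w', e', hw', hB, hH⟩ := hlow l hklW
    (fun θ => lower hlW ((X θ).pull (Tm.toFin hn))) ((hX.pull (Tm.toFin hn)).lower hlW)
  -- Chosen so that `3 * k ^ 2 / N₀`, multiplied by the bound for the number of patterns, equals `(ε
  -- / 2) ^ 2`. Rounding up at most doubles it, whence the constant 32 in the conclusion.
  set N₀ : ℝ := 12 * k ^ 2 * (ε ^ 2)⁻¹ * m ^ (2 * k ^ (d + 1)) with hN₀
  have hε2 : 1 ≤ (ε ^ 2)⁻¹ := (one_le_inv₀ (by positivity)).2 (pow_le_one₀ hε.le hε1)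
  have hN₀1 : 12 ≤ N₀ := by
    have h1 : (1 : ℝ) ≤ k ^ 2 := one_le_pow₀ hkR
    have h2 : (1 : ℝ) ≤ m ^ (2 * k ^ (d + 1)) := one_le_pow₀ hmR
    have h3 : (1 : ℝ) ≤ k ^ 2 * (ε ^ 2)⁻¹ := one_le_mul_of_one_le_of_one_le h1 hε2
    have h4 := one_le_mul_of_one_le_of_one_le h3 h2
    rw [hN₀]
    nlinarith
  set N := ⌈N₀⌉₊
  have hNge : N₀ ≤ N := Nat.le_ceil _
  have hNle : (N : ℝ) ≤ 2 * N₀ := by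
    have := Nat.ceil_lt_add_one (by linarith : 0 ≤ N₀)
    change (N : ℝ) < _ at this
    linarith
  have hN : 0 < N := by
    have : (0 : ℝ) < N := by linarith
    exact_mod_cast this
  have hpat : (2 * Fintype.card 𝒳 : ℝ) ^ (Fintype.card (Fin (d + 1) ↪o Fin k)) ≤
      m ^ (2 * k ^ (d + 1)) := by
    have h1 : (2 * Fintype.card 𝒳 : ℝ) ≤ m ^ 2 := by
      have : 2 * Fintype.card 𝒳 ≤ m ^ 2 := by nlinarith
      exact_mod_cast this
    rw [pow_mul]
    calc _ ≤ ((m : ℝ) ^ 2) ^ (Fintype.card (Fin (d + 1) ↪o Fin k)) :=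
          pow_le_pow_left₀ (by positivity) h1 _
      _ ≤ _ := pow_le_pow_right₀ (one_le_pow₀ hmR) (card_chain_fin_le _ _)
  obtain ⟨e, he⟩ := exists_model_of_condProb (k := k) hw' e' (g := g)
    (fun y => ⟨hg0 y, hg1 y⟩) hN (δ := ε / 2) (by positivity) (by
      have hN' : (0 : ℝ) < N := by exact_mod_cast hN
      calc _ ≤ (m : ℝ) ^ (2 * k ^ (d + 1)) * (3 * k ^ 2 * (1 / N)) := by gcongr
        _ = N₀ * (ε ^ 2 / 4) / N := by rw [hN₀]; field_simp; norm_num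
        _ ≤ N * (ε ^ 2 / 4) / N := by gcongr
        _ = (ε / 2) ^ 2 := by field_simp; norm_num)
  refine ⟨Ω × Fin N, inferInstance, blowUp w' N, e, isWeight_blowUp hw' hN, ?_, ?_⟩
  · rw [Fintype.card_prod, Fintype.card_fin]
    push_cast
    have : (N : ℝ) ≤ 32 * k ^ 2 * (ε ^ 2)⁻¹ * m ^ (2 * k ^ (d + 1)) := by
      have : 32 * k ^ 2 * (ε ^ 2)⁻¹ * m ^ (2 * k ^ (d + 1)) = 32 / 12 * N₀ := by rw [hN₀]; ring
      rw [this]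
      linarith
    have hB0 : 0 ≤ B := le_trans (Nat.cast_nonneg _) hB
    gcongr
  · intro ι F a
    have h1 := hX (Fin k) ι (((initial hkn).trans (Tm.top hW)).trans (Tm.toFin hn)) (pat F a)
      (abs_pat_le_one F a)
    have h2 := hg F a
    have h3 := hH (fun y => ∏ s ∈ F, g (bdry s y) (a s)) (fun y => abs_prod_le_one F _
      (fun _ => hg0 _ _) fun s => by
        rw [← hg1 (bdry s y)]
        exact Finset.single_le_sum (fun b _ => hg0 _ b) (Finset.mem_univ _))
    have h4 := he F a
    have h5 : (F.card : ℝ) * (√(theta (d + 1) k ε) + 2 * η) ≤ 3 * ε / 16 := by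
      have hF : (F.card : ℝ) ≤ k ^ (d + 1) := by
        exact_mod_cast (Finset.card_le_univ F).trans (card_chain_fin_le _ _)
      have h6 := sqrt_theta_le (d := d + 1) hk hε
      have hkd : (0 : ℝ) < k ^ (d + 1) := by positivity
      calc _ ≤ (F.card : ℝ) * (ε / (8 * k ^ (d + 1)) + 2 * (ε / (32 * k ^ (d + 1)))) := by gcongr
        _ ≤ (k : ℝ) ^ (d + 1) * (ε / (8 * k ^ (d + 1)) + 2 * (ε / (32 * k ^ (d + 1)))) := by
          gcongr
        _ = 3 * ε / 16 := by field_simp; norm_num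
    have h7 : η ≤ ε / 32 := by
      refine hη.trans ?_
      have : (1 : ℝ) ≤ k ^ (d + 1) := one_le_pow₀ hkR
      gcongr
      linarith
    have h2' : |(ex w fun θ => pat F a ((X θ).pull
        (((initial hkn).trans (Tm.top hW)).trans (Tm.toFin hn)))) - ex w fun θ =>
        ∏ s ∈ F, g (bdry s ((lower hlW ((X θ).pull (Tm.toFin hn))).pull (initial hkn))) (a s)| ≤
        3 * ε / 16 := h2.trans h5
    -- The errors are `ε / 16` for moving `ι` to the standard position, `3 * ε / 16` for conditional
    -- independence, `ε / 8` for the lower model and `ε / 2` for the colouring: together `7 * ε /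
    -- 8`.
    rw [abs_le] at *
    constructor <;> linarith [h1.1, h1.2, h2'.1, h2'.2, h3.1, h3.2, h4.1, h4.2]

/-! ### Numerical estimates -/

lemma pow_five_le_ell0 {d m k : ℕ} {ε : ℝ} (hk : 0 < k) (hm : 2 ≤ m) (hε : 0 < ε) (hε1 : ε ≤ 1) :
    k ^ 5 ≤ ell0 d m k ε := by
  refine Nat.pow_le_pow_right hk ?_
  have h1 := one_div_theta_ge (d := d) hk hε hε1
  have h2 : (1 : ℝ) ≤ (k : ℝ) ^ (2 * d) := one_le_pow₀ (by exact_mod_cast hk)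
  have h3 : 3 ≤ ⌊1 / theta d k ε⌋₊ := Nat.le_floor (by push_cast; linarith)
  nlinarith

lemma eta_le {d m k : ℕ} {ε : ℝ} (hk : 0 < k) (hm : 2 ≤ m) (hε : 0 < ε) (hε1 : ε ≤ 1) :
    eta (d + 1) m k ε ≤ ε / (32 * k ^ (d + 1)) := by
  have hkR : (1 : ℝ) ≤ k := by exact_mod_cast hk
  have hmR : (1 : ℝ) ≤ m := by exact_mod_cast (by omega : 1 ≤ m)
  have key : ∀ D r : ℕ, ε ^ 3 / (2 ^ 12 * (k : ℝ) ^ (3 * D)) * ((m : ℝ) ^ r)⁻¹ ≤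
      ε / (32 * k ^ D) := by
    intro D r
    have h1 : ((m : ℝ) ^ r)⁻¹ ≤ 1 := inv_le_one_of_one_le₀ (one_le_pow₀ hmR)
    have h2 : ε ^ 3 ≤ ε := pow_le_of_le_one hε.le hε1 (by norm_num)
    have h3 : (k : ℝ) ^ D ≤ k ^ (3 * D) := pow_le_pow_right₀ hkR (by omega)
    calc _ ≤ ε ^ 3 / (2 ^ 12 * (k : ℝ) ^ (3 * D)) * 1 := by gcongr
      _ ≤ ε / (32 * k ^ D) := by
        rw [mul_one]
        gcongr
        norm_num
  cases d with
  | zero =>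
    have := key 1 (3 * ell0 1 m k ε)
    simpa [eta] using this
  | succ d => exact (min_le_left _ _).trans (key (d + 2) _)

lemma two_le_mbar {d m k : ℕ} {ε : ℝ} (hd : 0 < d) (hk : 0 < k) (hm : 2 ≤ m) :
    2 ≤ mbar d m k ε := by
  refine hm.trans (Nat.le_self_pow ?_ m)
  have := Nat.mul_pos (ell0_pos (d := d) (m := m) (ε := ε) hk) hd
  positivity

lemma pow_ell0_le_mbar {d m k : ℕ} {ε : ℝ} (hd : 0 < d) (hm : 2 ≤ m) :
    m ^ ell0 d m k ε ≤ mbar d m k ε := by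
  refine Nat.pow_le_pow_right (by omega) ?_
  exact (Nat.le_mul_of_pos_right _ hd).trans (Nat.le_self_pow hd.ne' _)

lemma epsbar_pos {d m k : ℕ} {ε : ℝ} (hd : 0 < d) (hk : 0 < k) (hm : 2 ≤ m) (hε : 0 < ε) :
    0 < epsbar d m k ε := by
  have : (0 : ℝ) < mbar d m k ε := by
    exact_mod_cast (by norm_num : 0 < 2).trans_le (two_le_mbar hd hk hm)
  unfold epsbar; positivity

lemma epsbar_le_one {d m k : ℕ} {ε : ℝ} (hd : 0 < d) (hk : 0 < k) (hm : 2 ≤ m)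
    (hε1 : ε ≤ 1) : epsbar d m k ε ≤ 1 := by
  have : (1 : ℝ) ≤ mbar d m k ε := by
    exact_mod_cast (by norm_num : 1 ≤ 2).trans (two_le_mbar hd hk hm)
  unfold epsbar
  refine mul_le_one₀ (by linarith) (by positivity) (inv_le_one_of_one_le₀ (one_le_pow₀ this))

lemma eta_nonneg (k : ℕ) : ∀ (d m : ℕ) (ε : ℝ), 0 ≤ ε → 0 ≤ eta d m k ε
  | 0, _, _, _ => zero_le_one
  | 1, _, _, hε => by unfold eta; positivity
  | d + 2, m, ε, hε => by
    unfold eta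
    refine le_min (by positivity) (eta_nonneg k (d + 1) _ _ ?_)
    unfold epsbar; positivity

lemma le_n0 {k : ℕ} (hk : 0 < k) (d m : ℕ) (ε : ℝ) : k ≤ n0 (d + 1) m k ε := by
  cases d with
  | zero =>
    have := ell0_pos (d := 1) (m := m) (ε := ε) hk
    change k ≤ (k + 1) * k * ell0 1 m k ε
    rw [mul_comm (k + 1) k, mul_assoc]
    exact Nat.le_mul_of_pos_right _ (by positivity)
  | succ d =>
    have := ell0_pos (d := d + 2) (m := m) (ε := ε) hk
    change k ≤ k * ell0 (d + 2) m k ε *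
      (n0 (d + 1) (mbar (d + 2) m k ε) k (epsbar (d + 2) m k ε) + 1)
    rw [mul_assoc]
    exact Nat.le_mul_of_pos_right _ (by positivity)

/-- The template has `(d + 1) * l` points, the initial block included. This count is the source of
the exponent in `mbar`. -/
lemma card_blocks_le {𝒳 : Type*} [Fintype 𝒳] {d l m : ℕ} (h : Fintype.card 𝒳 ≤ m) (hm : 2 ≤ m) :
    Fintype.card (Arr (d + 1) (Tm (Fin d) l) 𝒳) ≤ m ^ ((d + 1) * l) ^ (d + 1) := by
  classical
  rw [Fintype.card_fun]
  have h1 : Fintype.card (Fin (d + 1) ↪o Tm (Fin d) l) ≤ ((d + 1) * l) ^ (d + 1) := by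
    have := card_chain_le (d := d + 1) (A := Tm (Fin d) l)
    rwa [card_tm, Fintype.card_fin] at this
  exact (Nat.pow_le_pow_left h _).trans (Nat.pow_le_pow_right (by omega) h1)

/-- Since `8 * k ^ 2 ≤ k ^ 5 ≤ ell0`, the unused half of the exponent `ell0` absorbs both powers of
`m`. -/
lemma v_one_ge {m k : ℕ} {ε : ℝ} (hk : 2 ≤ k) (hm : 2 ≤ m) (hε : 0 < ε) (hε1 : ε ≤ 1) :
    (m : ℝ) ^ (ell0 1 m k ε / 2) * (32 * k ^ 2 * (ε ^ 2)⁻¹ * m ^ (2 * k)) * m ^ (2 * k ^ 2) ≤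
      v 1 m k ε := by
  have hkR : (1 : ℝ) ≤ k := by exact_mod_cast (by omega : 1 ≤ k)
  have hmR : (1 : ℝ) ≤ m := by exact_mod_cast (by omega : 1 ≤ m)
  have hl : ell0 1 m k ε / 2 + 2 * k + 2 * k ^ 2 ≤ ell0 1 m k ε + 1 := by
    have h1 := pow_five_le_ell0 (d := 1) (by omega : 0 < k) hm hε hε1
    have h2 : 8 * k ^ 2 ≤ k ^ 5 := by
      have : 2 ^ 3 ≤ k ^ 3 := Nat.pow_le_pow_left hk 3
      calc 8 * k ^ 2 ≤ k ^ 3 * k ^ 2 := Nat.mul_le_mul_right _ this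
        _ = k ^ 5 := by ring
    have h3 : k ≤ k ^ 2 := Nat.le_self_pow (by norm_num) k
    omega
  have h1 : (ε ^ 2)⁻¹ ≤ (ε ^ 8)⁻¹ :=
    inv_anti₀ (by positivity) (pow_le_pow_of_le_one hε.le hε1 (by norm_num))
  have h2 : (k : ℝ) ^ 2 ≤ k ^ 8 := pow_le_pow_right₀ hkR (by norm_num)
  have h3 : (m : ℝ) ^ (ell0 1 m k ε / 2 + 2 * k + 2 * k ^ 2) ≤ m ^ (ell0 1 m k ε + 1) :=
    pow_le_pow_right₀ hmR hl
  calc _ = 32 * (m : ℝ) ^ (ell0 1 m k ε / 2 + 2 * k + 2 * k ^ 2) * k ^ 2 * (ε ^ 2)⁻¹ := by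
        rw [pow_add, pow_add]; ring
    _ ≤ 2 ^ 22 * (m : ℝ) ^ (ell0 1 m k ε + 1) * k ^ 8 * (ε ^ 8)⁻¹ := by
        gcongr
        norm_num
    _ = _ := rfl

lemma v_nonneg (k : ℕ) : ∀ (d m : ℕ) (ε : ℝ), 0 ≤ ε → 0 ≤ v d m k ε
  | 0, _, _, _ => zero_le_one
  | 1, _, _, hε => by unfold v; positivity
  | d + 2, m, ε, hε => by
    unfold v
    refine mul_nonneg (by positivity) (v_nonneg k (d + 1) _ _ ?_)
    unfold epsbar; positivity

/-- The recursion for `v` has no room for large powers of `m`. They are paid for by the slack `mbar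
^ (2 * k ^ (d + 2))` saved one dimension below, since `m ^ (k + 1) ≤ mbar`. -/
lemma v_succ_ge {d m k : ℕ} {ε : ℝ} (hk : 2 ≤ k) (hm : 2 ≤ m) (hε : 0 < ε) (hε1 : ε ≤ 1) :
    v (d + 1) (mbar (d + 2) m k ε) k (epsbar (d + 2) m k ε) /
        (mbar (d + 2) m k ε) ^ (2 * k ^ (d + 2)) *
        (32 * k ^ 2 * (ε ^ 2)⁻¹ * m ^ (2 * k ^ (d + 2))) * m ^ (2 * k ^ (d + 3)) ≤
      v (d + 2) m k ε := by
  have hkR : (1 : ℝ) ≤ k := by exact_mod_cast (by omega : 1 ≤ k)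
  have hmR : (1 : ℝ) ≤ m := by exact_mod_cast (by omega : 1 ≤ m)
  set V := v (d + 1) (mbar (d + 2) m k ε) k (epsbar (d + 2) m k ε) with hV
  have hV0 : 0 ≤ V := v_nonneg _ _ _ _ (epsbar_pos (by omega) (by omega) hm hε).le
  set q := mbar (d + 2) m k ε with hq
  have hq2 : 2 ≤ q := two_le_mbar (by omega) (by omega) hm
  have hq0 : (0 : ℝ) < q := by exact_mod_cast (by omega : 0 < q)
  have hmq : (m : ℝ) ^ (2 * k ^ (d + 2)) * m ^ (2 * k ^ (d + 3)) ≤ (q : ℝ) ^ (2 * k ^ (d + 2)) := by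
    have h1 : m ^ (k + 1) ≤ q := by
      refine le_trans (Nat.pow_le_pow_right (by omega) ?_) (pow_ell0_le_mbar (by omega) hm)
      refine le_trans ?_ (pow_five_le_ell0 (by omega) hm hε hε1)
      nlinarith [Nat.pow_le_pow_right (by omega : 0 < k) (by norm_num : 2 ≤ 5)]
    have h2 : (m : ℝ) ^ (k + 1) ≤ q := by exact_mod_cast h1
    calc _ = ((m : ℝ) ^ (k + 1)) ^ (2 * k ^ (d + 2)) := by
          rw [← pow_add, ← pow_mul]; congr 1; ring
      _ ≤ _ := pow_le_pow_left₀ (by positivity) h2 _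
  have h1 : (ε ^ 2)⁻¹ ≤ (ε ^ (2 ^ (d + 4)))⁻¹ :=
    inv_anti₀ (by positivity) (pow_le_pow_of_le_one hε.le hε1
      (by have := Nat.pow_le_pow_right (by norm_num : 0 < 2) (by omega : 1 ≤ d + 4)
          simpa using this))
  have h2 : (k : ℝ) ^ 2 ≤ k ^ ((d + 2) * 2 ^ (d + 4)) := pow_le_pow_right₀ hkR (by
    have := Nat.one_le_two_pow (n := d + 4)
    nlinarith)
  calc _ = 32 * 1 * (k : ℝ) ^ 2 * (ε ^ 2)⁻¹ * (V * (((m : ℝ) ^ (2 * k ^ (d + 2)) *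
        m ^ (2 * k ^ (d + 3))) / (q : ℝ) ^ (2 * k ^ (d + 2)))) := by ring
    _ ≤ 4 ^ 24 * m * (k : ℝ) ^ ((d + 2) * 2 ^ (d + 4)) * (ε ^ (2 ^ (d + 4)))⁻¹ * (V * 1) := by
        gcongr
        · norm_num
        · exact div_le_one_of_le₀ hmq (by positivity)
    _ = _ := by rw [mul_one]; rfl

/-! ### Models of spreadable arrays -/

lemma Spreads.mono {Θ I 𝒳 : Type*} [Fintype Θ] [LinearOrder I] {d : ℕ} {w : Θ → ℝ}
    {X : Θ → Arr d I 𝒳} {η η' : ℝ} (hX : Spreads w X η) (h : η ≤ η') : Spreads w X η' :=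
  fun A _ _ φ ψ G hG => (hX A φ ψ G hG).trans (by linarith)

/-- A 0-dimensional array has a single entry, so letting `ω₀` carry its law gives an exact model. -/
lemma ex_eq_modelEx_zero {Θ 𝒴 : Type*} [Fintype Θ] [Fintype 𝒴] {k n : ℕ} {w : Θ → ℝ}
    (Y : Θ → Arr 0 (Fin n) 𝒴) (f : Fin k ↪o Fin n) (u : Fin 0 ↪o Fin n)
    (hw : IsWeight fun y => ex w fun θ => ind (Y θ u) y) (H : Arr 0 (Fin k) 𝒴 → ℝ) :
    (ex w fun θ => H ((Y θ).pull f)) =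
      modelEx (fun y => ex w fun θ => ind (Y θ u) y) (fun ω₀ _ => ω₀) H := by
  unfold modelEx
  simp only [(isWeight_piW fun _ : Fin k => hw).ex_const]
  rw [← ex_comp (w := w) (π := fun θ => Y θ u) (fun _ => rfl)]
  congr 1
  funext θ
  congr 1
  funext s
  exact congrArg (Y θ) (DFunLike.ext _ _ fun i => i.elim0)

lemma isWeight_law {Θ 𝒴 : Type*} [Fintype Θ] [Fintype 𝒴] {w : Θ → ℝ} (hw : IsWeight w) (B : Θ → 𝒴) :
    IsWeight fun y => ex w fun θ => ind (B θ) y := by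
  refine ⟨fun y => hw.ex_nonneg fun _ => ind_nonneg _ _, ?_⟩
  rw [← ex_sum]
  simp only [sum_ind, hw.ex_const]

/-- The cardinality bound is strengthened by the factor `m ^ (2 * k ^ (d + 2))` so that the
induction closes. -/
theorem exists_model {k : ℕ} (hk : 2 ≤ k) {Θ : Type*} [Fintype Θ] {w : Θ → ℝ} (hw : IsWeight w) :
    ∀ d, d + 1 ≤ k → ∀ (m : ℕ) (ε : ℝ), 2 ≤ m → 0 < ε → ε ≤ 1 → ∀ n, n0 (d + 1) m k ε ≤ n →
    ∀ (𝒳 : Type) [Fintype 𝒳], Fintype.card 𝒳 ≤ m → ∀ X : Θ → Arr (d + 1) (Fin n) 𝒳,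
    Spreads w X (eta (d + 1) m k ε) →
    ∃ (Ω : Type) (_ : Fintype Ω) (w' : Ω → ℝ) (e : Ω → (Fin (d + 1) → Ω) → 𝒳), IsWeight w' ∧
      (Fintype.card Ω : ℝ) * m ^ (2 * k ^ (d + 2)) ≤ v (d + 1) m k ε ∧
      ∀ (ι : Fin k ↪o Fin n) (F : Finset (Fin (d + 1) ↪o Fin k))
        (a : (Fin (d + 1) ↪o Fin k) → 𝒳),
        |(ex w fun θ => pat F a ((X θ).pull ι)) - modelEx w' e (pat F a)| ≤ ε := by
  intro d
  induction d with
  | zero =>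
    intro hdk m ε hm hε hε1 n hn 𝒳 _ hcard X hX
    obtain ⟨Ω, hΩ, w', e, hw', hB, h⟩ := exists_model_of_lower (n' := k)
      (B := (m : ℝ) ^ (ell0 1 m k ε / 2)) hdk hm hε hε1 hcard
      le_rfl (le_trans (by
        have : n0 (0 + 1) m k ε = (k + 1) * k * ell0 1 m k ε := rfl
        rw [this, mul_comm (k + 1), mul_assoc, mul_comm (ell0 (0 + 1) m k ε)]
        exact Nat.le_mul_of_pos_left _ (by omega)) hn) hw hX (eta_le (by omega) hm hε hε1) (by
      intro l hl Y _
      let u : Fin 0 ↪o Fin k := OrderEmbedding.ofStrictMono (fun i => i.elim0) fun i => i.elim0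
      have hlaw := isWeight_law hw fun θ => Y θ u
      refine ⟨_, inferInstance, _, fun ω₀ _ => ω₀, hlaw, ?_, fun H _ => ?_⟩
      · have h1 := card_blocks_le (d := 0) (l := l) hcard hm
        -- From `2 * l ≤ k * l ≤ ell0`; this is where `2 ≤ k` saves half of the exponent.
        have h2 : ((0 + 1) * l) ^ (0 + 1) ≤ ell0 1 m k ε / 2 := by
          rw [zero_add, one_mul, pow_one, Nat.le_div_iff_mul_le (by norm_num)]
          refine le_trans ?_ hl
          rw [mul_comm]
          exact Nat.mul_le_mul_right _ hk
        exact_mod_cast h1.trans (Nat.pow_le_pow_right (by omega) h2)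
      · rw [ex_eq_modelEx_zero Y (initial le_rfl) u hlaw H, sub_self, abs_zero]
        positivity)
    refine ⟨Ω, hΩ, w', e, hw', le_trans ?_ (v_one_ge hk hm hε hε1), h⟩
    simp only [zero_add, pow_one] at hB ⊢
    gcongr
  | succ d ih =>
    intro hdk m ε hm hε hε1 n hn 𝒳 _ hcard X hX
    have hq2 : 2 ≤ mbar (d + 2) m k ε := two_le_mbar (by omega) (by omega) hm
    have hq0 : (0 : ℝ) < mbar (d + 2) m k ε := by exact_mod_cast (by omega)
    have hε' := epsbar_pos (d := d + 2) (k := k) (by omega) (by omega) hm hε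
    have hε1' := epsbar_le_one (d := d + 2) (k := k) (by omega) (by omega) hm hε1
    obtain ⟨Ω, hΩ, w', e, hw', hB, h⟩ := exists_model_of_lower
      (n' := n0 (d + 1) (mbar (d + 2) m k ε) k (epsbar (d + 2) m k ε))
      (B := v (d + 1) (mbar (d + 2) m k ε) k (epsbar (d + 2) m k ε) /
        (mbar (d + 2) m k ε) ^ (2 * k ^ (d + 2))) hdk hm hε hε1 hcard
      (le_n0 (by omega) _ _ _) (le_trans (by
        have : n0 (d + 1 + 1) m k ε = k * ell0 (d + 2) m k ε *
          (n0 (d + 1) (mbar (d + 2) m k ε) k (epsbar (d + 2) m k ε) + 1) := rfl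
        rw [this, mul_assoc]
        exact Nat.le_mul_of_pos_left _ (by omega)) hn) hw hX (eta_le (by omega) hm hε hε1) (by
      intro l hl Y hY
      have hl' : l ≤ ell0 (d + 2) m k ε := (Nat.le_mul_of_pos_left l (by omega)).trans hl
      have hcY : Fintype.card (Arr (d + 1 + 1) (Tm (Fin (d + 1)) l) 𝒳) ≤ mbar (d + 2) m k ε := by
        refine (card_blocks_le hcard hm).trans (Nat.pow_le_pow_right (by omega) ?_)
        rw [mul_comm]
        gcongr
      obtain ⟨Ω, hΩ, w', e, hw', hB, h⟩ := ih (by omega) _ _ hq2 hε' hε1' _ le_rfl _ hcY Y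
        (hY.mono (min_le_right _ _))
      refine ⟨Ω, hΩ, w', e, hw', ?_, fun H hH => ?_⟩
      · rwa [le_div_iff₀ (by positivity)]
      · refine (abs_ex_sub_modelEx_le (fun a => h (initial _) Finset.univ a) H hH).trans ?_
        calc _ ≤ (mbar (d + 2) m k ε : ℝ) ^ (k ^ (d + 1)) * epsbar (d + 2) m k ε := by
              refine mul_le_mul_of_nonneg_right ?_ hε'.le
              calc _ ≤ (mbar (d + 2) m k ε : ℝ) ^ Fintype.card (Fin (d + 1) ↪o Fin k) := by
                    gcongr
                _ ≤ _ := pow_le_pow_right₀ (by exact_mod_cast (by omega)) (card_chain_fin_le _ _)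
          _ = ε / 8 := by
            have : epsbar (d + 2) m k ε =
              ε / 8 * ((mbar (d + 2) m k ε : ℝ) ^ (k ^ (d + 1)))⁻¹ := rfl
            rw [this]
            field_simp)
    refine ⟨Ω, hΩ, w', e, hw', le_trans ?_ (v_succ_ge hk hm hε hε1), h⟩
    exact mul_le_mul_of_nonneg_right hB (by positivity)

/-- For `k ≥ 2` the slack in `exists_model` leaves room for `m` extra points. For `k = 1` only
single entries are tested, and the law of one entry serves as vertex weight. -/
theorem exists_model_of_spreads {Θ : Type*} [Fintype Θ] {w : Θ → ℝ} (hw : IsWeight w)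
    {d m k n : ℕ} {ε : ℝ} (hdk : d + 1 ≤ k) (hm : 2 ≤ m) (hε : 0 < ε) (hε1 : ε ≤ 1)
    (hn : n0 (d + 1) m k ε ≤ n) {𝒳 : Type} [Fintype 𝒳] (hcard : Fintype.card 𝒳 ≤ m)
    {X : Θ → Arr (d + 1) (Fin n) 𝒳} (hX : Spreads w X (eta (d + 1) m k ε)) :
    ∃ (Ω : Type) (_ : Fintype Ω) (w' : Ω → ℝ) (e : Ω → (Fin (d + 1) → Ω) → 𝒳), IsWeight w' ∧
      (Fintype.card Ω : ℝ) + m ≤ v (d + 1) m k ε ∧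
      ∀ (ι : Fin k ↪o Fin n) (F : Finset (Fin (d + 1) ↪o Fin k))
        (a : (Fin (d + 1) ↪o Fin k) → 𝒳),
        |(ex w fun θ => pat F a ((X θ).pull ι)) - modelEx w' e (pat F a)| ≤ ε := by
  have hmR : (2 : ℝ) ≤ m := by exact_mod_cast hm
  rcases (by omega : 2 ≤ k ∨ k = 1) with hk | hk
  · obtain ⟨Ω, hΩ, w', e, hw', hB, h⟩ := exists_model hk hw d hdk m ε hm hε hε1 n hn 𝒳 hcard X hX
    refine ⟨Ω, hΩ, w', e, hw', le_trans ?_ hB, h⟩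
    have h1 : (1 : ℝ) ≤ Fintype.card Ω := by
      have := hw'.nonempty
      exact_mod_cast Fintype.card_pos
    have h2 : (m : ℝ) ^ 2 ≤ m ^ (2 * k ^ (d + 2)) :=
      pow_le_pow_right₀ (by linarith) (by
        have : 0 < k ^ (d + 2) := Nat.pow_pos (by omega)
        omega)
    calc (Fintype.card Ω : ℝ) + m ≤ Fintype.card Ω * m ^ 2 := by
          have : (0 : ℝ) ≤ (Fintype.card Ω - 1) * (m ^ 2 - 1) :=
            mul_nonneg (by linarith) (by nlinarith)
          nlinarith
      _ ≤ _ := by gcongr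
  · subst hk
    obtain rfl : d = 0 := by omega
    have hn1 : 1 ≤ n := (le_n0 one_pos 0 m ε).trans hn
    let u : Fin (0 + 1) ↪o Fin 1 := RelEmbedding.refl _
    refine ⟨𝒳, inferInstance, fun y => ex w fun θ => ind ((X θ).pull (initial hn1) u) y,
      fun _ z => z 0, isWeight_law hw _, ?_, fun ι F a => ?_⟩
    · have h1 : (Fintype.card 𝒳 : ℝ) ≤ m := by exact_mod_cast hcard
      have h2 : (1 : ℝ) ≤ (ε ^ 8)⁻¹ :=
        (one_le_inv₀ (by positivity)).2 (pow_le_one₀ hε.le hε1)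
      have h3 : (m : ℝ) ^ 1 ≤ m ^ (ell0 1 m 1 ε + 1) :=
        pow_le_pow_right₀ (by linarith) (by omega)
      calc _ ≤ 2 ^ 22 * (m : ℝ) ^ 1 * ((1 : ℕ) : ℝ) ^ 8 * 1 := by
            push_cast; linarith
        _ ≤ 2 ^ 22 * (m : ℝ) ^ (ell0 1 m 1 ε + 1) * ((1 : ℕ) : ℝ) ^ 8 * (ε ^ 8)⁻¹ := by gcongr
    · have hlaw := isWeight_law hw fun θ => (X θ).pull (initial hn1) u
      have e1 : modelEx (d := 0 + 1) (k := 1)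
          (fun y => ex w fun θ => ind ((X θ).pull (initial hn1) u) y)
          (fun _ z => z 0) (pat F a) = ex w fun θ => pat F a ((X θ).pull (initial hn1)) := by
        unfold modelEx
        have e2 : ∀ ω : Fin 1 → 𝒳, (fun s : Fin (0 + 1) ↪o Fin 1 => (ω ∘ s) 0) =
            fun _ => ω 0 := fun ω => funext fun s => congrArg ω (Subsingleton.elim _ _)
        simp only [e2]
        rw [hlaw.ex_const, ex_piW_apply (fun _ => hlaw) 0 fun x => pat F a fun _ => x,
          ← ex_comp (w := w) (π := fun θ => (X θ).pull (initial hn1) u) (fun _ => rfl)]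
        congr 1
        funext θ
        congr 1
        funext s
        exact congrArg _ (DFunLike.ext _ _ fun i => Subsingleton.elim _ _)
      rw [e1]
      have h1 := hX (Fin 1) ι (initial hn1) (pat F a) (abs_pat_le_one F a)
      have h2 := eta_le (d := 0) (k := 1) one_pos hm hε hε1
      norm_num at h2
      refine h1.trans ?_
      norm_num
      linarith

/-! ### Adjoining null points -/

/-- The weights on `Ω ⊕ 𝒳` concentrated on `Ω`. -/
def nullExt {Ω : Type*} (𝒳 : Type*) (w : Ω → ℝ) : Ω ⊕ 𝒳 → ℝ := Sum.elim w fun _ => 0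

lemma ex_nullExt {Ω 𝒳 : Type*} [Fintype Ω] [Fintype 𝒳] {w : Ω → ℝ} (f : Ω ⊕ 𝒳 → ℝ) :
    ex (nullExt 𝒳 w) f = ex w (f ∘ Sum.inl) := by
  simp [ex, nullExt]

lemma isWeight_nullExt {Ω 𝒳 : Type*} [Fintype Ω] [Fintype 𝒳] {w : Ω → ℝ} (hw : IsWeight w) :
    IsWeight (nullExt 𝒳 w) := by
  refine ⟨?_, by simpa [nullExt] using hw.sum_eq_one⟩
  rintro (x | x)
  · exact hw.nonneg x
  · exact le_rfl

/-- Every model can be made surjective by adjoining null points. -/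
lemma exists_modelEx_nullExt {Ω 𝒳 : Type*} [Fintype Ω] [Fintype 𝒳] {d : ℕ} {w : Ω → ℝ}
    (hw : IsWeight w) (e : Ω → (Fin d → Ω) → 𝒳) :
    ∃ e' : Ω ⊕ 𝒳 → (Fin d → Ω ⊕ 𝒳) → 𝒳, (∀ a z, e' (Sum.inr a) z = a) ∧
      ∀ (k : ℕ) (H : Arr d (Fin k) 𝒳 → ℝ), modelEx (nullExt 𝒳 w) e' H = modelEx w e H := by
  obtain ⟨x₀⟩ := hw.nonempty
  -- Null points in the remaining coordinates are read as `x₀`; a null point in coordinate 0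
  -- dictates the colour.
  let π : Ω ⊕ 𝒳 → Ω := Sum.elim id fun _ => x₀
  refine ⟨fun ω₀ z => Sum.elim (fun x => e x (π ∘ z)) id ω₀, fun _ _ => rfl, fun k H => ?_⟩
  unfold modelEx
  rw [ex_nullExt]
  congr 1
  funext ω₀
  have hπ : ∀ y, (ex (nullExt 𝒳 w) fun x => ind (π x) y) = w y := fun y => by
    rw [ex_nullExt]
    exact ex_ind_left y
  rw [← ex_piW_comp hπ]
  rfl

/-! ### Measures on finite sets -/

section Finite

/-- The measure with given weights. -/
def toMeasure {Ω : Type*} [Fintype Ω] [MeasurableSpace Ω] (w : Ω → ℝ) : Measure Ω :=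
  ∑ x, ENNReal.ofReal (w x) • Measure.dirac x

lemma toMeasure_singleton {Ω : Type*} [Fintype Ω] [MeasurableSpace Ω] [DiscreteMeasurableSpace Ω]
    (w : Ω → ℝ) (x : Ω) : toMeasure w {x} = ENNReal.ofReal (w x) := by
  classical
  simp [toMeasure, Set.indicator_apply]

lemma isProbabilityMeasure_toMeasure {Ω : Type*} [Fintype Ω] [MeasurableSpace Ω] {w : Ω → ℝ}
    (hw : IsWeight w) : IsProbabilityMeasure (toMeasure w) := by
  constructor
  simp [toMeasure, ← ENNReal.ofReal_sum_of_nonneg fun x _ => hw.nonneg x, hw.sum_eq_one]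

/-- The joint distribution of finitely many coordinates of an infinite product. -/
lemma infinitePi_map_comp {Ω κ : Type*} [Fintype κ] [Nonempty κ] [MeasurableSpace Ω]
    (μ : Measure Ω) [IsProbabilityMeasure μ] (r : κ → ℕ) (hr : Function.Injective r) :
    (Measure.infinitePi fun _ : ℕ => μ).map (fun ω => ω ∘ r) = Measure.pi fun _ => μ := by
  classical
  symm
  refine Measure.pi_eq fun s hs => ?_
  have hm : Measurable fun ω : ℕ → Ω => ω ∘ r :=
    measurable_pi_lambda _ fun i => measurable_pi_apply _
  rw [Measure.map_apply hm (MeasurableSet.univ_pi hs)]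
  have e1 : (fun ω : ℕ → Ω => ω ∘ r) ⁻¹' Set.univ.pi s =
      Set.pi (Finset.univ.image r : Finset ℕ) fun j => s (Function.invFun r j) := by
    ext ω
    simp [Set.mem_pi, Function.leftInverse_invFun hr _]
  rw [e1, Measure.infinitePi_pi _ fun i _ => hs _, Finset.prod_image fun _ _ _ _ h => hr h]
  simp [Function.leftInverse_invFun hr _]

lemma integral_infinitePi_eq_ex {Ω : Type*} [Fintype Ω] [MeasurableSpace Ω]
    [DiscreteMeasurableSpace Ω] {k : ℕ} {w : Ω → ℝ} (hw : IsWeight w) (c : Fin k → ℕ)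
    (hc : Function.Injective c) (hc0 : ∀ i, c i ≠ 0) (f : Ω → (Fin k → Ω) → ℝ) :
    ∫ ω : ℕ → Ω, f (ω 0) (ω ∘ c) ∂(Measure.infinitePi fun _ : ℕ => toMeasure w) =
      ex w fun ω₀ => ex (piW fun _ => w) fun ω => f ω₀ ω := by
  have := isProbabilityMeasure_toMeasure hw
  have hr : Function.Injective (Fin.cons 0 c : Fin (k + 1) → ℕ) :=
    Fin.cons_injective_iff.2 ⟨fun ⟨i, hi⟩ => hc0 i hi, hc⟩
  have e1 := integral_map (μ := Measure.infinitePi fun _ : ℕ => toMeasure w)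
    (φ := fun ω => ω ∘ (Fin.cons 0 c : Fin (k + 1) → ℕ))
    (f := fun z : Fin (k + 1) → Ω => f (z 0) fun i => z i.succ)
    (measurable_pi_lambda _ fun i => measurable_pi_apply _).aemeasurable
    (measurable_of_finite _).aestronglyMeasurable
  rw [infinitePi_map_comp _ _ hr] at e1
  refine e1.symm.trans ?_
  rw [integral_fintype .of_finite]
  simp only [ex, piW, Finset.mul_sum]
  rw [← Fintype.sum_prod_type', ← (Fin.consEquiv fun _ : Fin (k + 1) => Ω).sum_comp]
  refine Finset.sum_congr rfl fun x _ => ?_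
  rw [measureReal_def, Measure.pi_singleton, ENNReal.toReal_prod, Fin.prod_univ_succ]
  simp only [toMeasure_singleton, ENNReal.toReal_ofReal (hw.nonneg _), smul_eq_mul, mul_assoc]
  rfl

/-- The worst case is the `ℓ¹` distance, whose positive and negative parts are each at most the
total variation distance. -/
lemma abs_integral_sub_le_tvDist {α : Type*} [Fintype α] [MeasurableSpace α]
    [DiscreteMeasurableSpace α] (μ ν : Measure α) [IsProbabilityMeasure μ] [IsProbabilityMeasure ν]
    (G : α → ℝ) (hG : ∀ x, |G x| ≤ 1) : |∫ x, G x ∂μ - ∫ x, G x ∂ν| ≤ 2 * tvDist μ ν := by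
  classical
  have htv : ∀ A : Finset α, |∑ x ∈ A, (μ.real {x} - ν.real {x})| ≤ tvDist μ ν := by
    intro A
    rw [Finset.sum_sub_distrib, sum_measureReal_singleton, sum_measureReal_singleton]
    refine le_ciSup (f := fun A : {A : Set α // MeasurableSet A} => |μ.real A - ν.real A|) ?_
      ⟨(A : Set α), .of_discrete⟩
    refine ⟨1, ?_⟩
    rintro _ ⟨B, rfl⟩
    have h1 : μ.real (B : Set α) ≤ 1 := measureReal_le_one
    have h2 : ν.real (B : Set α) ≤ 1 := measureReal_le_one
    have h3 : 0 ≤ μ.real (B : Set α) := measureReal_nonneg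
    have h4 : 0 ≤ ν.real (B : Set α) := measureReal_nonneg
    exact abs_le.2 ⟨by linarith, by linarith⟩
  rw [integral_fintype .of_finite, integral_fintype .of_finite, ← Finset.sum_sub_distrib]
  have h1 : ∀ x ∈ Finset.univ, |μ.real {x} • G x - ν.real {x} • G x| ≤
      |μ.real {x} - ν.real {x}| := fun x _ => by
    rw [← sub_smul, smul_eq_mul, abs_mul]
    exact mul_le_of_le_one_right (abs_nonneg _) (hG x)
  refine (Finset.abs_sum_le_sum_abs _ _).trans ((Finset.sum_le_sum h1).trans ?_)
  rw [← Finset.sum_filter_add_sum_filter_not _ fun x => 0 ≤ μ.real {x} - ν.real {x}, two_mul]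
  refine add_le_add ?_ ?_
  · rw [Finset.sum_congr rfl fun x hx => abs_of_nonneg (Finset.mem_filter.1 hx).2]
    exact le_of_abs_le (htv _)
  · rw [Finset.sum_congr rfl fun x hx => abs_of_neg (not_le.1 (Finset.mem_filter.1 hx).2),
      Finset.sum_neg_distrib]
    exact (neg_le_abs _).trans (htv _)

end Finite

/-! ### The law of a random array -/

section Law

variable {S Θ : Type*} [MeasurableSpace S] [Fintype Θ] [MeasurableSpace Θ]
  [DiscreteMeasurableSpace Θ]

/-- The weights of the law of a random variable with finitely many values. -/
def lawW (P : Measure S) (Z : S → Θ) (x : Θ) : ℝ := (P.map Z).real {x}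

lemma ex_lawW {P : Measure S} [IsProbabilityMeasure P] {Z : S → Θ} (hZ : Measurable Z) (f : Θ → ℝ) :
    ex (lawW P Z) f = ∫ ω, f (Z ω) ∂P := by
  have := Measure.isProbabilityMeasure_map (μ := P) hZ.aemeasurable
  rw [← integral_map hZ.aemeasurable (measurable_of_finite f).aestronglyMeasurable,
    integral_fintype .of_finite]
  rfl

lemma isWeight_lawW {P : Measure S} [IsProbabilityMeasure P] {Z : S → Θ} (hZ : Measurable Z) :
    IsWeight (lawW P Z) := by
  refine ⟨fun x => measureReal_nonneg, ?_⟩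
  simpa [ex] using ex_lawW (P := P) hZ fun _ => 1

end Law

/-! ### Translation between `d`-subsets and increasing chains. -/

open Set.powersetCard in
lemma map_ofFinEmbEquiv {A B : Type*} [LinearOrder A] [LinearOrder B] {d : ℕ} (f : A ↪o B)
    (u : Fin d ↪o A) : Set.powersetCard.map d f.toEmbedding (ofFinEmbEquiv u) =
      ofFinEmbEquiv (u.trans f) := by
  apply SetLike.coe_injective
  rw [coe_map, ofFinEmbEquiv_apply, ofFinEmbEquiv_apply, coe_ofFinEmb, coe_ofFinEmb]
  exact (Set.range_comp _ _).symm

open Set.powersetCard in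
/-- Spreadability in total variation implies spreadability tested against bounded functions. -/
lemma IsSpreadable.spreads {S 𝒳 : Type*} [MeasurableSpace S] [Fintype 𝒳] [MeasurableSpace 𝒳]
    [DiscreteMeasurableSpace 𝒳] {n d : ℕ} {P : Measure S} [IsProbabilityMeasure P]
    {X : Set.powersetCard (Fin n) d → S → 𝒳} (hX : ∀ s, Measurable (X s)) {η : ℝ} (hη : 0 ≤ η)
    (h : IsSpreadable P X η) {𝒴 : Type*} (σ : 𝒳 → 𝒴) :
    Spreads (lawW P fun ω s => X s ω)
      (fun x (t : Fin d ↪o Fin n) => σ (x (ofFinEmbEquiv t))) η := by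
  classical
  intro A _ _ φ ψ G hG
  have := Fintype.ofFinite A
  by_cases hp : d ≤ Fintype.card A
  · let J : (A ↪o Fin n) → Finset (Fin n) := fun φ => Finset.univ.map φ.toEmbedding
    have hJ : ∀ φ, (J φ).card = Fintype.card A := fun φ => Finset.card_map _
    let i : Fin (Fintype.card A) ≃o A := Fintype.orderIsoFinOfCardEq A rfl
    have hemb : ∀ φ, (J φ).orderEmbOfFin (hJ φ) = i.toOrderEmbedding.trans φ := fun φ =>
      (Finset.orderEmbOfFin_unique' (hJ φ) fun x =>
        Finset.mem_map_of_mem _ (Finset.mem_univ _)).symm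
    let G' : (Set.powersetCard (Fin (Fintype.card A)) d → 𝒳) → ℝ := fun y =>
      G fun u => σ (y (ofFinEmbEquiv (u.trans i.symm.toOrderEmbedding)))
    have hmeas : ∀ φ : A ↪o Fin n, Measurable fun ω
        (t : Set.powersetCard (Fin (Fintype.card A)) d) =>
        X (Set.powersetCard.map d ((J φ).orderEmbOfFin (hJ φ)).toEmbedding t) ω := fun φ =>
      measurable_pi_lambda _ fun t => hX _
    have key : ∀ φ : A ↪o Fin n, (ex (lawW P fun ω s => X s ω) fun x =>
        G (Arr.pull φ fun t : Fin d ↪o Fin n => σ (x (ofFinEmbEquiv t)))) =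
        ∫ y, G' y ∂(subarrayLaw P X (J φ) (hJ φ)) := by
      intro φ
      rw [ex_lawW (measurable_pi_lambda _ fun s => hX s), subarrayLaw,
        integral_map (hmeas φ).aemeasurable (measurable_of_finite _).aestronglyMeasurable]
      congr 1
      funext ω
      simp only [G']
      congr 1
      funext u
      simp only [Arr.pull, map_ofFinEmbEquiv, hemb]
      congr 3
      refine DFunLike.ext _ _ fun j => ?_
      change φ (u j) = φ (i (i.symm (u j)))
      rw [i.apply_symm_apply]
    rw [key φ, key ψ]
    have hprob : ∀ φ, IsProbabilityMeasure (subarrayLaw P X (J φ) (hJ φ)) := fun φ =>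
      Measure.isProbabilityMeasure_map (hmeas φ).aemeasurable
    have := hprob φ
    have := hprob ψ
    refine (abs_integral_sub_le_tvDist _ _ G' fun y => hG _).trans ?_
    have := h _ hp (J φ) (J ψ) (hJ φ) (hJ ψ)
    linarith
  -- With fewer than `d` points spreadability says nothing, but there are no chains and all arrays
  -- coincide.
  · have hemp : IsEmpty (Fin d ↪o A) := ⟨fun u => hp (by
      simpa using Fintype.card_le_of_injective u u.injective)⟩
    have : ∀ x y : Arr d A 𝒴, x = y := fun x y => Subsingleton.elim _ _
    rw [show (fun θ : Set.powersetCard (Fin n) d → 𝒳 => G (Arr.pull φ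
      fun t : Fin d ↪o Fin n => σ (θ (ofFinEmbEquiv t)))) = fun θ => G (Arr.pull ψ
      fun t : Fin d ↪o Fin n => σ (θ (ofFinEmbEquiv t))) from funext fun θ => congrArg G (this _ _)]
    simpa using hη

open Set.powersetCard in
lemma prod_eq_prod_chains {n d k : ℕ} (M : Finset (Fin n)) (hM : M.card = k)
    (F : Finset (Set.powersetCard (Fin n) d)) (hF : ∀ s ∈ F, (s : Finset (Fin n)) ⊆ M)
    (h : Set.powersetCard (Fin n) d → ℝ) :
    open Classical in
    ∏ s ∈ F, h s = ∏ t : Fin d ↪o Fin k with ofFinEmbEquiv (t.trans (M.orderEmbOfFin hM)) ∈ F,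
      h (ofFinEmbEquiv (t.trans (M.orderEmbOfFin hM))) := by
  classical
  symm
  refine Finset.prod_bij (fun t _ => ofFinEmbEquiv (t.trans (M.orderEmbOfFin hM)))
    (fun t ht => (Finset.mem_filter.1 ht).2) ?_ ?_ fun _ _ => rfl
  · intro t _ t' _ e
    have e1 := ofFinEmbEquiv.injective e
    exact DFunLike.ext _ _ fun i => (M.orderEmbOfFin hM).injective (DFunLike.congr_fun e1 i)
  · intro s hs
    obtain ⟨t, ht⟩ := exists_trans_eq (M.orderEmbOfFin hM) (ofFinEmbEquiv.symm s) (by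
      intro i
      rw [Finset.range_orderEmbOfFin]
      apply hF s hs
      have := (mem_range_ofFinEmbEquiv_symm_iff_mem s (ofFinEmbEquiv.symm s i)).1 ⟨i, rfl⟩
      exact this)
    have e : ofFinEmbEquiv (t.trans (M.orderEmbOfFin hM)) = s := by
      rw [ht, Equiv.apply_symm_apply]
    exact ⟨t, Finset.mem_filter.2 ⟨Finset.mem_univ _, e ▸ hs⟩, e⟩

open Set.powersetCard in
lemma restrict_ofFinEmbEquiv {Ω : Type*} {n d : ℕ} (ω : ℕ → Ω) (u : Fin d ↪o Fin n) :
    restrict ω (ofFinEmbEquiv u) = Fin.cons (ω 0) fun i => ω (u i + 1) := by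
  unfold restrict
  congr 1
  funext i
  have : ofFinEmbEquiv.symm (ofFinEmbEquiv u) = u := Equiv.symm_apply_apply _ _
  rw [ofFinEmbEquiv_symm_apply] at this
  exact congrArg (fun f : Fin d ↪o Fin n => ω (f i + 1)) this

lemma indicator_eq_ind {α β : Type*} (f : α → β) (b : β) (z : α) :
    ({z | f z = b} : Set α).indicator (fun _ => (1 : ℝ)) z = ind (f z) b := by
  classical
  by_cases h : f z = b
  · rw [Set.indicator_of_mem (by exact h)]; simp [ind, h]
  · rw [Set.indicator_of_notMem (by exact h)]; simp [ind, h]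

end SpreadableArray

end

/-! ### The main theorem. -/

open SpreadableArray Set.powersetCard in
theorem theorem4p1 (d m k : ℕ) (hd : 1 ≤ d) (hm : 2 ≤ m) (hk : d ≤ k)
    (ε : ℝ) (hε : 0 < ε) (hε1 : ε ≤ 1)
    (n : ℕ) (hn : SpreadableArray.n0 d m k ε ≤ n)
    {𝒳 : Type*} [Fintype 𝒳] [MeasurableSpace 𝒳] [DiscreteMeasurableSpace 𝒳]
    (h𝒳 : Fintype.card 𝒳 = m)
    {S : Type*} [MeasurableSpace S] (P : Measure S) [IsProbabilityMeasure P]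
    (X : Set.powersetCard (Fin n) d → S → 𝒳) (hX : ∀ s, Measurable (X s))
    (hspread : SpreadableArray.IsSpreadable P X (SpreadableArray.eta d m k ε)) :
    ∃ (Ω : Type) (_ : Fintype Ω) (_ : MeasurableSpace Ω) (_ : DiscreteMeasurableSpace Ω)
      (μ : Measure Ω) (_ : IsProbabilityMeasure μ) (E : 𝒳 → Set (Fin (d + 1) → Ω)),
      (Fintype.card Ω : ℝ) ≤ SpreadableArray.v d m k ε ∧
      SpreadableArray.IsPartition E ∧
      ∀ M : Finset (Fin n), M.card = k →
        ∀ F : Finset (Set.powersetCard (Fin n) d), F.Nonempty →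
          (∀ s ∈ F, (s : Finset (Fin n)) ⊆ M) →
          ∀ a : Set.powersetCard (Fin n) d → 𝒳,
            |P.real (⋂ s ∈ F, {x | X s x = a s}) -
              ∫ ω : ℕ → Ω, ∏ s ∈ F,
                (E (a s)).indicator (fun _ => (1 : ℝ)) (SpreadableArray.restrict ω s)
                ∂(Measure.infinitePi fun _ : ℕ => μ)| ≤ ε := by
  classical
  obtain ⟨d, rfl⟩ : ∃ d', d = d' + 1 := ⟨d - 1, by omega⟩
  -- Colours are moved to `Fin m` because `𝒳` may live in any universe while `Ω` must be in `Type`.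
  let σ : 𝒳 ≃ Fin m := Fintype.equivFinOfCardEq h𝒳
  have hXm : Measurable fun (ω : S) (s : Set.powersetCard (Fin n) (d + 1)) => X s ω :=
    measurable_pi_lambda _ fun s => hX s
  obtain ⟨Ω₀, _, w₀, e₀, hw₀, hcard, hmodel⟩ := exists_model_of_spreads (isWeight_lawW (P := P) hXm)
    hk hm hε hε1 hn (Fintype.card_fin m).le
    (IsSpreadable.spreads hX (eta_nonneg k _ m ε hε.le) hspread σ)
  obtain ⟨e, he, hee⟩ := exists_modelEx_nullExt (𝒳 := Fin m) hw₀ e₀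
  have hw := isWeight_nullExt (𝒳 := Fin m) hw₀
  let _ : MeasurableSpace (Ω₀ ⊕ Fin m) := ⊤
  have : DiscreteMeasurableSpace (Ω₀ ⊕ Fin m) := ⟨fun _ => trivial⟩
  refine ⟨Ω₀ ⊕ Fin m, inferInstance, ⊤, this, toMeasure (nullExt (Fin m) w₀),
    isProbabilityMeasure_toMeasure hw,
    fun a => {z | e (z 0) (fun i => z i.succ) = σ a}, ?_, ⟨?_, ?_, ?_⟩, ?_⟩
  · rw [Fintype.card_sum, Fintype.card_fin]
    exact_mod_cast hcard
  -- The adjoined null point labelled `σ a` lies in the class of `a`, so no class is empty.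
  · exact fun a => ⟨fun _ => Sum.inr (σ a), he _ _⟩
  · intro a b hab
    refine Set.disjoint_left.2 fun z hz hz' => hab (σ.injective ?_)
    exact Eq.trans (Eq.symm hz) hz'
  · refine Set.eq_univ_of_forall fun z => Set.mem_iUnion.2 ⟨σ.symm (e (z 0) fun i => z i.succ), ?_⟩
    exact (σ.apply_symm_apply _).symm
  · intro M hM F _ hF a
    let ι := M.orderEmbOfFin hM
    let F' : Finset (Fin (d + 1) ↪o Fin k) :=
      Finset.univ.filter fun t => ofFinEmbEquiv (t.trans ι) ∈ F
    let a' : (Fin (d + 1) ↪o Fin k) → Fin m := fun t => σ (a (ofFinEmbEquiv (t.trans ι)))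
    have h1 : P.real (⋂ s ∈ F, {x | X s x = a s}) =
        ex (lawW P fun ω s => X s ω) fun x => pat F' a' (Arr.pull ι
          fun t : Fin (d + 1) ↪o Fin n => σ (x (ofFinEmbEquiv t))) := by
      have hmeas : MeasurableSet (⋂ s ∈ F, {x | X s x = a s}) :=
        Finset.measurableSet_biInter _ fun s _ => hX s (.singleton (a s))
      rw [ex_lawW hXm, ← integral_indicator_one hmeas]
      congr 1
      funext x
      have e1 : ∏ s ∈ F, ind (σ (X s x)) (σ (a s)) = pat F' a' (Arr.pull ι
          fun t : Fin (d + 1) ↪o Fin n => σ (X (ofFinEmbEquiv t) x)) :=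
        prod_eq_prod_chains M hM F hF fun s => ind (σ (X s x)) (σ (a s))
      rw [← e1]
      by_cases hx : x ∈ ⋂ s ∈ F, {x | X s x = a s}
      · rw [Set.indicator_of_mem hx, Finset.prod_eq_one]
        · rfl
        · intro s hs
          have : X s x = a s := by simpa using Set.mem_iInter₂.1 hx s hs
          simp [ind, this]
      · rw [Set.indicator_of_notMem hx]
        simp only [Set.mem_iInter, not_forall] at hx
        obtain ⟨s, hs, hne⟩ := hx
        rw [Finset.prod_eq_zero hs]
        have : X s x ≠ a s := hne
        simp [ind, this]
    have h2 : ∫ ω : ℕ → Ω₀ ⊕ Fin m, ∏ s ∈ F,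
        ({z : Fin (d + 1 + 1) → Ω₀ ⊕ Fin m | e (z 0) (fun i => z i.succ) = σ (a s)}).indicator
          (fun _ => (1 : ℝ)) (restrict ω s)
          ∂(Measure.infinitePi fun _ : ℕ => toMeasure (nullExt (Fin m) w₀)) =
        modelEx (nullExt (Fin m) w₀) e (pat F' a') := by
      -- The vertex `i` of `Fin n` reads coordinate `i + 1`, so coordinate 0 stays free for `ω₀`.
      refine Eq.trans ?_ (integral_infinitePi_eq_ex hw (fun i : Fin k => (ι i : ℕ) + 1)
        (fun i j h => ι.injective (Fin.ext (Nat.succ_injective h))) (fun i => Nat.succ_ne_zero _)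
        fun ω₀ ω => pat F' a' fun s => e ω₀ (ω ∘ s))
      congr 1
      funext ω
      refine (prod_eq_prod_chains M hM F hF _).trans (Finset.prod_congr rfl fun t _ => ?_)
      rw [restrict_ofFinEmbEquiv]
      exact indicator_eq_ind (fun z : Fin (d + 1 + 1) → Ω₀ ⊕ Fin m => e (z 0) fun i => z i.succ) _ _
    rw [h1]
    refine le_trans (le_of_eq ?_) (hmodel ι F' a')
    rw [← hee]
    exact congrArg _ (congrArg _ h2)
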